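/- **Conventions.** All diagrams lie on the sphere $S^2$ and are polygonal, with finitely many edges, each a great-circle arc shorter than a half circle; their only singularities are transversal double points. For $n\in\mathbb N$, a *linkoid diagram* with $n$ components is a generic immersion of $n$ intervals in $S^2$ with over/under data at every crossing; it has $2n$ endpoints. Two linkoid diagrams are *equivalent* if they are related by a finite sequence of isotopies of $S^2$ and Reidemeister moves $R_1,R_2,R_3$ performed away from the endpoints (no strand may be moved over or under an endpoint); a *linkoid* is an equivalence class. A *virtual link diagram* is a generic immersion of finitely many (unoriented) circles in $S^2$ in which each crossing is either classical (with over/under data) or virtual; a *virtual link* is an equivalence class of such diagrams under isotopy, the Reidemeister moves $R_1,R_2,R_3$ for classical crossings, and detour moves (a segment of the diagram all of whose crossings are virtual is replaced by any other generic segment with the same ends, all of whose crossings are taken to be virtual; this includes the virtual and semi-virtual Reidemeister moves). Label the endpoints of a linkoid diagram $L$ with $n$ components bijectively by $E=\{1,\dots,2n\}$, and let $H_n=\{\sigma\in S_{2n}:\sigma^2(i)=i,\ \sigma(i)\ne i\ \text{for all } i\in E\}$ be the set of *closure permutations*. For $\sigma\in H_n$, a *virtual closure diagram* of the labelled diagram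 $L$ with respect to $\sigma$ is a virtual link diagram consisting of $L$ and, for each pair $\{i,\sigma(i)\}$, a closure arc joining the endpoints labelled $i$ and $\sigma(i)$, where all crossings on the closure arcs are virtual. The *virtual spectrum* $\operatorname{spec}(L)$ is the set of all virtual links represented by virtual closure diagrams of $L$ with respect to some $\sigma\in H_n$. **Theorem 5.1.** Let $n\in\mathbb N$. 1. For every labelled linkoid diagram $L$ with $n$ components and every $\sigma\in H_n$, virtual closure diagrams of $L$ with respect to $\sigma$ exist and they all represent one and the same virtual link $(L,\sigma)_v$; thus $\operatorname{spec}(L)=\{(L,\sigma)_v:\sigma\in H_n\}$. 2. The virtual spectrum is a linkoid invariant: if $L_1$ and $L_2$ are equivalent linkoid diagrams with $n$ components, with arbitrary labellings of their endpoints, then $\operatorname{spec}(L_1)=\operatorname{spec}(L_2)$. -/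

import Mathlib

/-! Linkoid diagrams and virtual link diagrams on the sphere, in the piecewise linear category:
curves are polygons whose edges are arcs of great circles shorter than a half circle. -/

namespace VirtualSpectrum

/-- The unit sphere in Euclidean 3-space, on which all diagrams lie. -/
abbrev S2 : Type := Metric.sphere (0 : EuclideanSpace ℝ (Fin 3)) 1

/-- The closed great-circle arc (shorter than a half circle) spanned by an unordered pair of points:
the points of the sphere that are non-negative combinations of the two points. -/
def arc (e : Sym2 S2) : Set S2 :=
  {x | ∃ p q : S2, e = s(p, q) ∧ ∃ a b : ℝ, 0 ≤ a ∧ 0 ≤ b ∧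
    (x : EuclideanSpace ℝ (Fin 3)) = a • (p : EuclideanSpace ℝ (Fin 3)) + b • (q : EuclideanSpace ℝ (Fin 3))}

/-- The closed spherical triangle with vertices `p`, `q`, `r`. -/
def triangle (p q r : S2) : Set S2 :=
  {x | ∃ a b c : ℝ, 0 ≤ a ∧ 0 ≤ b ∧ 0 ≤ c ∧
    (x : EuclideanSpace ℝ (Fin 3)) = a • (p : EuclideanSpace ℝ (Fin 3))
      + b • (q : EuclideanSpace ℝ (Fin 3)) + c • (r : EuclideanSpace ℝ (Fin 3))}

/-- Two different edges meet in a point that is interior to both of them. -/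
def Crosses (e f : Sym2 S2) : Prop :=
  e ≠ f ∧ ∃ x : S2, x ∈ arc e ∧ x ∈ arc f ∧ x ∉ e ∧ x ∉ f

/-- A generic polygonal curve diagram on the sphere, with finitely many edges, possibly with several
components, closed or open, and with classical and virtual crossings.
The relation `isOver e f` says that the edges `e` and `f` have a classical crossing at which `e` is the
upper one; a crossing of two edges neither of which is over the other is a virtual crossing.
(Two edges cross at most once, because they are shorter than a half circle.) -/
structure Diagram where
  /-- the edges, given by their pairs of end vertices -/
  edges : Set (Sym2 S2)
  finite_edges : edges.Finite
  /-- the two vertices of an edge are neither equal nor antipodal -/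
  nondegenerate : ∀ p q : S2, s(p, q) ∈ edges → p ≠ q ∧ p ≠ -q
  /-- Two edges meet only in common vertices and in points interior to both. As a consequence they
  cannot overlap, so that they cross transversally in the latter case. -/
  generic : ∀ e ∈ edges, ∀ f ∈ edges, e ≠ f → ∀ x ∈ arc e ∩ arc f, (x ∈ e ↔ x ∈ f)
  /-- No point lies on three edges: all crossings are double points, and a vertex lies on at most two
  edges, so that the edges form a disjoint union of polygonal arcs and closed polygons. -/
  no_triple : ∀ e ∈ edges, ∀ f ∈ edges, ∀ g ∈ edges, e ≠ f → f ≠ g → e ≠ g →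
    arc e ∩ arc f ∩ arc g = ∅
  /-- the over/under data of the classical crossings -/
  isOver : Sym2 S2 → Sym2 S2 → Prop
  crosses_of_isOver : ∀ e f, isOver e f → e ∈ edges ∧ f ∈ edges ∧ Crosses e f
  isOver_asymm : ∀ e f, isOver e f → ¬ isOver f e

namespace Diagram

/-- The endpoints of the open components: the vertices that lie on exactly one edge. -/
def endpoints (D : Diagram) : Set S2 :=
  {p | ∃! e : Sym2 S2, e ∈ D.edges ∧ p ∈ e}

/-- The edges `e` and `f` have a classical crossing. -/
def Classical (D : Diagram) (e f : Sym2 S2) : Prop := D.isOver e f ∨ D.isOver f e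

/-- `D'` arises from `D` by replacing the edge `pq` by the two edges `pr` and `rq` of a
non-degenerate triangle `pqr`, nothing being changed on the other edges of `D`. -/
def Replaces (D D' : Diagram) (p q r : S2) : Prop :=
  LinearIndependent ℝ ![(p : EuclideanSpace ℝ (Fin 3)), (q : EuclideanSpace ℝ (Fin 3)),
    (r : EuclideanSpace ℝ (Fin 3))] ∧
  s(p, q) ∈ D.edges ∧ s(p, r) ∉ D.edges ∧ s(r, q) ∉ D.edges ∧
  D'.edges = (D.edges \ {s(p, q)}) ∪ {s(p, r), s(r, q)} ∧
  ∀ e ∈ D.edges \ {s(p, q)}, ∀ f ∈ D.edges \ {s(p, q)}, (D'.isOver e f ↔ D.isOver e f)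

/-- An edge meets the triangle `pqr` at most in the vertices `p` and `q`. -/
def Away (p q r : S2) (e : Sym2 S2) : Prop := arc e ∩ triangle p q r ⊆ {p, q}

/-- An edge traverses the triangle `pqr`, entering through the side `pq` and leaving through one of
the two other sides. -/
def Traverses (p q r : S2) (e : Sym2 S2) : Prop :=
  Crosses e s(p, q) ∧ (Crosses e s(p, r) ∨ Crosses e s(r, q))

/-- An edge `e` crosses the new edges `pr`, `rq` in the same way (over, under, or virtually) as it
crossed the old edge `pq`. -/
def SameType (D D' : Diagram) (p q r : S2) (e : Sym2 S2) : Prop :=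
  ∀ g ∈ ({s(p, r), s(r, q)} : Set (Sym2 S2)), Crosses e g →
    ((D'.isOver e g ↔ D.isOver e s(p, q)) ∧ (D'.isOver g e ↔ D.isOver s(p, q) e))

/-- Elementary planar isotopy: the edge `pq` is pushed across the triangle `pqr`, where the rest of the
diagram meets the triangle only in `p`, `q` and in pairwise disjoint segments
that run from `pq` to the two other sides. No crossing is created, removed or changed. -/
def Isotopy (D D' : Diagram) : Prop :=
  ∃ p q r : S2, Replaces D D' p q r ∧
    (∀ e ∈ D.edges \ {s(p, q)}, Away p q r e ∨ Traverses p q r e) ∧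
    (∀ e ∈ D.edges \ {s(p, q)}, ∀ f ∈ D.edges \ {s(p, q)}, e ≠ f →
      arc e ∩ arc f ∩ triangle p q r = ∅) ∧
    ∀ e ∈ D.edges \ {s(p, q)}, SameType D D' p q r e

/-- First Reidemeister move: of two consecutive edges `pq`, `qs` the first one is replaced by `pr`, `rq`
so that a kink arises, with one classical crossing, of `pr` and `qs`; the rest of the
diagram stays away from the triangle. -/
def ReidemeisterI (D D' : Diagram) : Prop :=
  ∃ p q r s : S2, Replaces D D' p q r ∧
    s(q, s) ∈ D.edges \ {s(p, q)} ∧ Crosses s(q, s) s(p, r) ∧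
    D'.Classical s(q, s) s(p, r) ∧
    ∀ e ∈ D.edges \ {s(p, q)}, e ≠ s(q, s) → Away p q r e

/-- Second Reidemeister move: the edge `pq` is pushed entirely over, or entirely under, a segment of
another edge `e`, which cuts off the corner `r` of the triangle; the rest of the
diagram stays away from the triangle. -/
def ReidemeisterII (D D' : Diagram) : Prop :=
  ∃ (p q r : S2) (e : Sym2 S2), Replaces D D' p q r ∧
    e ∈ D.edges \ {s(p, q)} ∧ Crosses e s(p, r) ∧ Crosses e s(r, q) ∧
    ((D'.isOver s(p, r) e ∧ D'.isOver s(r, q) e) ∨ (D'.isOver e s(p, r) ∧ D'.isOver e s(r, q))) ∧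
    ∀ f ∈ D.edges \ {s(p, q)}, f ≠ e → Away p q r f

/-- Third Reidemeister move: the edge `pq` is pushed across the crossing of two edges `e` and `f`, which
lies in the triangle. The three crossings involved are classical, one of the three
strands is over the two others, and the crossing types are kept; the rest of the
diagram stays away from the triangle. -/
def ReidemeisterIII (D D' : Diagram) : Prop :=
  ∃ (p q r : S2) (e f : Sym2 S2), Replaces D D' p q r ∧
    e ∈ D.edges \ {s(p, q)} ∧ f ∈ D.edges \ {s(p, q)} ∧ e ≠ f ∧
    Traverses p q r e ∧ Traverses p q r f ∧ (arc e ∩ arc f ∩ triangle p q r).Nonempty ∧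
    ((D.isOver s(p, q) e ∧ D.isOver s(p, q) f ∧ D.Classical e f) ∨
      (D.isOver e s(p, q) ∧ D.isOver e f ∧ D.Classical s(p, q) f) ∨
      (D.isOver f s(p, q) ∧ D.isOver f e ∧ D.Classical s(p, q) e)) ∧
    SameType D D' p q r e ∧ SameType D D' p q r f ∧
    ∀ g ∈ D.edges \ {s(p, q)}, g ≠ e → g ≠ f → Away p q r g

/-- Planar isotopy of a diagram near an endpoint `p`: the open component that ends in `p` is prolonged by
a new edge from `p` to `p'` that is disjoint from the rest of the diagram. (The
inverse of this move shortens the component; together they move endpoints about in the complement of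
the diagram, and no endpoint ever passes over or under a strand.) -/
def EndpointIsotopy (D D' : Diagram) : Prop :=
  ∃ p p' : S2, p ∈ D.endpoints ∧ s(p, p') ∉ D.edges ∧ D'.edges = insert s(p, p') D.edges ∧
    (∀ e ∈ D.edges, arc e ∩ arc s(p, p') ⊆ {p}) ∧
    ∀ e f, D'.isOver e f ↔ D.isOver e f

/-- The set `A` of edges forms a simple polygonal path of edges with end vertices `p` and `q`
(its edges may cross each other). -/
def IsPathBetween (A : Set (Sym2 S2)) (p q : S2) : Prop :=
  ∃ w : (SimpleGraph.fromEdgeSet A).Walk p q, w.IsPath ∧ {e | e ∈ w.edges} = A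

/-- Detour move: a path `A` of edges all of whose crossings are virtual is removed and replaced by
another path `B` with the same end vertices, all of whose crossings are again virtual. The
virtual Reidemeister moves and the semi-virtual move are special cases. -/
def Detour (D D' : Diagram) : Prop :=
  ∃ (C A B : Set (Sym2 S2)) (p q : S2), Disjoint C A ∧ Disjoint C B ∧
    D.edges = C ∪ A ∧ D'.edges = C ∪ B ∧ IsPathBetween A p q ∧ IsPathBetween B p q ∧
    (∀ e f, D.isOver e f → e ∈ C ∧ f ∈ C) ∧ ∀ e f, D'.isOver e f ↔ D.isOver e f

end Diagram

/-- A linkoid diagram with `n` components: only open components, all crossings classical.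
(There being no closed component, `n` open components are the same as `2 * n` endpoints.) -/
structure LinkoidDiagram (n : ℕ) extends Diagram where
  no_closed_component : (SimpleGraph.fromEdgeSet edges).IsAcyclic
  card_endpoints : toDiagram.endpoints.ncard = 2 * n
  all_classical : ∀ e ∈ edges, ∀ f ∈ edges, Crosses e f → toDiagram.Classical e f

/-- One Reidemeister move or elementary isotopy between linkoid diagrams. -/
def LinkoidMove {n : ℕ} (L L' : LinkoidDiagram n) : Prop :=
  L.toDiagram.Isotopy L'.toDiagram ∨ L.toDiagram.EndpointIsotopy L'.toDiagram ∨
  L.toDiagram.ReidemeisterI L'.toDiagram ∨ L.toDiagram.ReidemeisterII L'.toDiagram ∨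
  L.toDiagram.ReidemeisterIII L'.toDiagram

/-- Equivalence of linkoid diagrams: the equivalence relation generated by the three Reidemeister moves
and isotopy. A linkoid is an equivalence class. -/
def LinkoidEquiv {n : ℕ} : LinkoidDiagram n → LinkoidDiagram n → Prop :=
  Relation.EqvGen LinkoidMove

/-- A virtual link diagram: all components are closed. -/
structure VirtualLinkDiagram extends Diagram where
  no_endpoints : toDiagram.endpoints = ∅

/-- One Reidemeister move, elementary isotopy or detour move between virtual link diagrams. -/
def VirtualMove (D D' : VirtualLinkDiagram) : Prop :=
  D.toDiagram.Isotopy D'.toDiagram ∨ D.toDiagram.ReidemeisterI D'.toDiagram ∨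
  D.toDiagram.ReidemeisterII D'.toDiagram ∨ D.toDiagram.ReidemeisterIII D'.toDiagram ∨
  D.toDiagram.Detour D'.toDiagram

/-- Equivalence of virtual link diagrams. -/
def virtualSetoid : Setoid VirtualLinkDiagram := Relation.EqvGen.setoid VirtualMove

/-- A virtual link is an equivalence class of virtual link diagrams. -/
def VirtualLink : Type := Quotient virtualSetoid

/-- The virtual link represented by a diagram. -/
def VirtualLinkDiagram.toLink (D : VirtualLinkDiagram) : VirtualLink := Quotient.mk virtualSetoid D

/-- A labelling of the endpoints of a linkoid diagram by `2 * n` labels, without repetition. (It determines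
the strand permutation, which exchanges the labels of the two endpoints of every component.) -/
abbrev LinkoidDiagram.Labelling {n : ℕ} (L : LinkoidDiagram n) : Type :=
  Fin (2 * n) ≃ L.toDiagram.endpoints

/-- The set `H_n` of closure permutations: the involutions of the labels without fixed points. -/
def closurePermutations (n : ℕ) : Set (Equiv.Perm (Fin (2 * n))) :=
  {σ | ∀ i, σ (σ i) = i ∧ σ i ≠ i}

/-- `D` is a virtual closure diagram of the labelled linkoid diagram `(L, l)` with respect to `σ`: it
consists of `L` and of closure arcs `A i`, one between the endpoints labelled `i` and `σ i` for
every `i`; all crossings on the closure arcs are virtual. -/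
def IsClosureDiagram {n : ℕ} (L : LinkoidDiagram n) (l : L.Labelling)
    (σ : Equiv.Perm (Fin (2 * n))) (D : VirtualLinkDiagram) : Prop :=
  ∃ A : Fin (2 * n) → Set (Sym2 S2),
    (∀ i, Diagram.IsPathBetween (A i) (l i) (l (σ i))) ∧
    (∀ i, A (σ i) = A i) ∧
    (∀ i j, j ≠ i → j ≠ σ i → Disjoint (A i) (A j)) ∧
    (∀ i, Disjoint L.edges (A i)) ∧
    D.edges = L.edges ∪ ⋃ i, A i ∧
    ∀ e f, D.isOver e f ↔ L.isOver e f

/-- The virtual link `v` is a virtual closure of `(L, l)` with respect to `σ`. -/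
def IsVirtualClosure {n : ℕ} (L : LinkoidDiagram n) (l : L.Labelling)
    (σ : Equiv.Perm (Fin (2 * n))) (v : VirtualLink) : Prop :=
  ∃ D : VirtualLinkDiagram, IsClosureDiagram L l σ D ∧ D.toLink = v

/-- The virtual spectrum: the set of the virtual closures with respect to all closure permutations. -/
def spec {n : ℕ} (L : LinkoidDiagram n) (l : L.Labelling) : Set VirtualLink :=
  {v | ∃ σ ∈ closurePermutations n, IsVirtualClosure L l σ v}

end VirtualSpectrum

/-! Closure arcs have only virtual crossings, so a detour move exchanges the closure arc between two
endpoints for a path of two edges through any point `c` on no great circle through two vertices or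
double points of the rest of the diagram. As a point `c` suitable for two diagrams at once exists
in every nonempty open set, two closures with respect to `σ` become equal after one detour for each
pair of endpoints. Relabelling the endpoints only conjugates `σ`.

A Reidemeister move or an isotopy exchanges the edge `pq` for the path `p`, `r`, `q`. If all three
barycentric coordinates of `c` with respect to `p`, `q`, `r` are negative, then an arc to `c` from
`p`, from `q` or from a point outside the triangle meets the triangle at most in `p` and `q`. Both
diagrams can therefore be closed by the same arcs away from the triangle, and the move carries over
to the closures. An edge that is added at an endpoint becomes a part of the closure arc. -/

namespace VirtualSpectrum

open Set Submodule

local notation "ℝ³" => EuclideanSpace ℝ (Fin 3)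

section SpanPair

variable {K V : Type*} [Field K] [AddCommGroup V] [Module K V]

lemma finrank_span_pair_le_two (x y : V) : Module.finrank K (span K {x, y}) ≤ 2 := by
  classical
  exact (finrank_span_le_card {x, y}).trans (by simpa using Finset.card_le_two (a := x))

lemma span_pair_eq_of_mem {u v x y : V} (hx : x ∈ span K {u, v}) (hy : y ∈ span K {u, v})
    (h : LinearIndependent K ![x, y]) : span K {x, y} = span K {u, v} := by
  have : FiniteDimensional K (span K {u, v}) := .span_of_finite K (toFinite _)
  refine eq_of_le_of_finrank_le (span_le.mpr (pair_subset hx hy)) ?_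
  rw [← Matrix.range_cons_cons_empty x y ![], finrank_span_eq_card h, Fintype.card_fin]
  exact finrank_span_pair_le_two u v

lemma span_pair_ne_top (hV : 2 < Module.finrank K V) (x y : V) : span K {x, y} ≠ ⊤ := by
  intro h
  have hle := finrank_span_pair_le_two (K := K) x y
  rw [h, finrank_top] at hle
  exact hle.not_gt hV

end SpanPair

section Sphere

variable {p q u v x y : S2}

lemma norm_coe_sphere (p : S2) : ‖(p : ℝ³)‖ = 1 := norm_eq_of_mem_sphere p

lemma coe_sphere_ne_zero (p : S2) : (p : ℝ³) ≠ 0 := ne_zero_of_mem_unit_sphere p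

lemma eq_of_coe_eq_smul {a : ℝ} (ha : 0 ≤ a) (h : (x : ℝ³) = a • (p : ℝ³)) : x = p := by
  have hxp : SameRay ℝ (x : ℝ³) p := h ▸ SameRay.sameRay_nonneg_smul_left _ ha
  exact Subtype.ext (hxp.eq_of_norm_eq (by simp only [norm_coe_sphere]))

lemma linearIndependent_pair (h₁ : p ≠ q) (h₂ : p ≠ -q) :
    LinearIndependent ℝ ![(p : ℝ³), (q : ℝ³)] := by
  by_contra h
  rcases sameRay_or_sameRay_neg_iff_not_linearIndependent.mpr h with h | h
  · exact h₁ (Subtype.ext (h.eq_of_norm_eq (by simp only [norm_coe_sphere])))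
  · exact h₂ (Subtype.ext (h.eq_of_norm_eq (by simp only [norm_neg, norm_coe_sphere])))

lemma mem_arc_mk : x ∈ arc s(p, q) ↔
    ∃ a b : ℝ, 0 ≤ a ∧ 0 ≤ b ∧ (x : ℝ³) = a • (p : ℝ³) + b • (q : ℝ³) := by
  refine ⟨?_, fun h => ⟨p, q, rfl, h⟩⟩
  rintro ⟨p', q', he, a, b, ha, hb, hx⟩
  rcases Sym2.eq_iff.mp he with ⟨rfl, rfl⟩ | ⟨rfl, rfl⟩
  · exact ⟨a, b, ha, hb, hx⟩
  · exact ⟨b, a, hb, ha, hx.trans (add_comm _ _)⟩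

lemma left_mem_arc (p q : S2) : p ∈ arc s(p, q) :=
  mem_arc_mk.mpr ⟨1, 0, zero_le_one, le_rfl, by simp⟩

lemma right_mem_arc (p q : S2) : q ∈ arc s(p, q) :=
  mem_arc_mk.mpr ⟨0, 1, le_rfl, zero_le_one, by simp⟩

lemma mem_arc_of_mem {e : Sym2 S2} (h : x ∈ e) : x ∈ arc e := by
  obtain ⟨y, rfl⟩ := h
  exact left_mem_arc x y

lemma mem_span_of_mem_arc (h : x ∈ arc s(p, q)) : (x : ℝ³) ∈ span ℝ {(p : ℝ³), (q : ℝ³)} := by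
  obtain ⟨a, b, -, -, hx⟩ := mem_arc_mk.mp h
  exact mem_span_pair.mpr ⟨a, b, hx.symm⟩

lemma mem_arc_of_smul_eq {a b t : ℝ} (ht : 0 < t) (ha : 0 ≤ a) (hb : 0 ≤ b)
    (h : t • (x : ℝ³) = a • (p : ℝ³) + b • (q : ℝ³)) : x ∈ arc s(p, q) := by
  refine mem_arc_mk.mpr ⟨t⁻¹ * a, t⁻¹ * b, by positivity, by positivity, ?_⟩
  rw [mul_smul, mul_smul, ← smul_add, ← h, inv_smul_smul₀ ht.ne']

lemma exists_pos_of_mem_arc (hx : x ∈ arc s(p, q)) (h : x ∉ s(p, q)) :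
    ∃ a b : ℝ, 0 < a ∧ 0 < b ∧ (x : ℝ³) = a • (p : ℝ³) + b • (q : ℝ³) := by
  obtain ⟨a, b, ha, hb, hab⟩ := mem_arc_mk.mp hx
  rw [Sym2.mem_iff, not_or] at h
  refine ⟨a, b, ha.lt_of_ne' ?_, hb.lt_of_ne' ?_, hab⟩ <;> rintro rfl
  · exact h.2 (eq_of_coe_eq_smul hb (by simpa using hab))
  · exact h.1 (eq_of_coe_eq_smul ha (by simpa using hab))

lemma arc_subset_arc_of_mem (hx : x ∈ arc s(u, v)) : arc s(u, x) ⊆ arc s(u, v) := by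
  intro y hy
  obtain ⟨a, b, ha, hb, hx⟩ := mem_arc_mk.mp hx
  obtain ⟨c, d, hc, hd, hy⟩ := mem_arc_mk.mp hy
  refine mem_arc_mk.mpr ⟨c + d * a, d * b, by positivity, by positivity, ?_⟩
  rw [hy, hx]
  module

lemma eq_of_mem_arc_of_mem_arc (h₁ : u ≠ v) (h₂ : u ≠ -v) (hx : x ∈ arc s(u, v))
    (hv : v ∈ arc s(u, x)) : x = v := by
  by_contra hxv
  have hu : x ≠ u := by
    rintro rfl
    obtain ⟨a, b, ha, hb, hv⟩ := mem_arc_mk.mp hv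
    exact h₁ (eq_of_coe_eq_smul (add_nonneg ha hb) (by rw [hv]; module)).symm
  obtain ⟨a, b, ha, -, hx⟩ := exists_pos_of_mem_arc hx (by simp [hu, hxv])
  obtain ⟨c, d, hc, hd, hv⟩ := mem_arc_mk.mp hv
  have hzero : c + d * a = 0 :=
    (LinearIndependent.pair_iff.mp (linearIndependent_pair h₁ h₂) _ (d * b - 1) (by
      rw [hx] at hv
      linear_combination (norm := module) -hv)).1
  have hd0 : d = 0 := by nlinarith [mul_nonneg hd ha.le]
  have hc0 : c = 0 := by simpa [hd0] using hzero
  exact coe_sphere_ne_zero v (by simpa [hc0, hd0] using hv)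

lemma ne_neg_of_mem_arc (h₁ : p ≠ q) (h₂ : p ≠ -q) (hx : x ∈ arc s(p, q))
    (hy : y ∈ arc s(p, q)) : x ≠ -y := by
  obtain ⟨a, b, ha, hb, hx⟩ := mem_arc_mk.mp hx
  obtain ⟨c, d, hc, hd, hy⟩ := mem_arc_mk.mp hy
  intro hxy
  have hxy : (x : ℝ³) = -(y : ℝ³) := congrArg Subtype.val hxy
  obtain ⟨hac, hbd⟩ := LinearIndependent.pair_iff.mp (linearIndependent_pair h₁ h₂) (a + c) (b + d)
    (by rw [hx, hy] at hxy; linear_combination (norm := module) hxy)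
  refine coe_sphere_ne_zero x ?_
  rw [hx, show a = 0 by linarith, show b = 0 by linarith, zero_smul, zero_smul, add_zero]

lemma left_mem_arc_or_right_mem_arc (hxpq : x ∈ arc s(p, q)) (hx' : x ∉ s(p, q))
    (hu : (u : ℝ³) ∈ span ℝ {(p : ℝ³), (q : ℝ³)}) (hu' : u ∉ arc s(p, q)) (hux : u ≠ -x) :
    p ∈ arc s(u, x) ∨ q ∈ arc s(u, x) := by
  obtain ⟨a, b, ha, hb, hx⟩ := exists_pos_of_mem_arc hxpq hx'
  obtain ⟨c, d, hcd⟩ := mem_span_pair.mp hu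
  wlog hd : d < 0 generalizing p q a b c d
  · have hc : c < 0 := by
      by_contra! hc
      exact hu' (mem_arc_mk.mpr ⟨c, d, hc, not_lt.mp hd, hcd.symm⟩)
    rw [Sym2.eq_swap] at hxpq hx' hu'
    rw [pair_comm] at hu
    exact (this hxpq hx' hu hu' b a hb ha (hx.trans (add_comm _ _)) d c
      ((add_comm _ _).trans hcd) hc).symm
  have hp : (c * b - d * a) • (p : ℝ³) = b • (u : ℝ³) - d • (x : ℝ³) := by rw [hx, ← hcd]; module
  have hq : (c * b - d * a) • (q : ℝ³) = c • (x : ℝ³) - a • (u : ℝ³) := by rw [hx, ← hcd]; module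
  rcases lt_trichotomy (c * b - d * a) 0 with hD | hD | hD
  · have hc : c < 0 := by nlinarith
    exact .inr (mem_arc_of_smul_eq (neg_pos.mpr hD) ha.le (neg_nonneg.mpr hc.le)
      (by linear_combination (norm := module) -hq))
  · refine absurd (eq_of_coe_eq_smul (a := -d / b) (by bound) ?_) hux
    have hu : (u : ℝ³) = b⁻¹ • d • (x : ℝ³) := by
      rw [eq_inv_smul_iff₀ hb.ne', ← sub_eq_zero, ← hp, hD, zero_smul]
    rw [hu, coe_neg_sphere]
    module
  · exact .inl (mem_arc_of_smul_eq hD hb.le (neg_nonneg.mpr hd.le)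
      (by linear_combination (norm := module) hp))

/-- Two edges as `Diagram.generic` requires of the edges of a diagram. -/
def MeetGenerically (e f : Sym2 S2) : Prop := ∀ x ∈ arc e ∩ arc f, (x ∈ e ↔ x ∈ f)

lemma MeetGenerically.symm {e f : Sym2 S2} (h : MeetGenerically e f) : MeetGenerically f e :=
  fun x hx => (h x hx.symm).symm

lemma MeetGenerically.left_mem (h : MeetGenerically s(p, q) s(u, v)) (hu : u ≠ v) (hu' : u ≠ -v)
    (hspan : span ℝ {(u : ℝ³), (v : ℝ³)} = span ℝ {(p : ℝ³), (q : ℝ³)})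
    (hx : x ∈ arc s(p, q) ∩ arc s(u, v)) (hx' : x ∉ s(p, q)) : u ∈ s(p, q) := by
  have hx'' : x ∉ s(u, v) := fun hxuv => hx' ((h x hx).mpr hxuv)
  by_contra hmem
  have hu'' : u ∉ arc s(p, q) := fun hupq =>
    hmem ((h u ⟨hupq, left_mem_arc u v⟩).mpr (Sym2.mem_mk_left u v))
  have notMem_of_mem {w : S2} (hw : w ∈ s(p, q)) : w ∉ arc s(u, x) := by
    intro hwx
    have hwarc := mem_arc_of_mem hw
    rcases Sym2.mem_iff.mp
      ((h w ⟨hwarc, arc_subset_arc_of_mem hx.2 hwx⟩).mp hw) with rfl | rfl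
    · exact hmem hw
    · exact hx'' (eq_of_mem_arc_of_mem_arc hu hu' hx.2 hwx ▸ Sym2.mem_mk_right u x)
  rcases left_mem_arc_or_right_mem_arc hx.1 hx'
    (hspan ▸ subset_span (mem_insert _ _)) hu'' (ne_neg_of_mem_arc hu hu' (left_mem_arc u v) hx.2)
    with hpux | hqux
  · exact notMem_of_mem (Sym2.mem_mk_left p q) hpux
  · exact notMem_of_mem (Sym2.mem_mk_right p q) hqux

lemma MeetGenerically.eq_of_coplanar (h : MeetGenerically s(p, q) s(u, v)) (hu : u ≠ v)
    (hu' : u ≠ -v) (hspan : span ℝ {(u : ℝ³), (v : ℝ³)} = span ℝ {(p : ℝ³), (q : ℝ³)})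
    (hx : x ∈ arc s(p, q) ∩ arc s(u, v)) (hx' : x ∉ s(p, q)) : s(p, q) = s(u, v) := by
  have hv : v ∈ s(p, q) := by
    rw [Sym2.eq_swap (a := u)] at h hx
    exact h.left_mem hu.symm (fun hvu => hu' (by rw [hvu, neg_neg])) (by rwa [pair_comm]) hx hx'
  exact (Sym2.mem_and_mem_iff hu).mp ⟨h.left_mem hu hu' hspan hx hx', hv⟩

lemma MeetGenerically.finite_inter (h : MeetGenerically s(p, q) s(u, v)) (hp : p ≠ q)
    (hp' : p ≠ -q) (hu : u ≠ v) (hu' : u ≠ -v) (hne : s(p, q) ≠ s(u, v)) :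
    (arc s(p, q) ∩ arc s(u, v)).Finite := by
  by_contra hinf
  obtain ⟨x, hx, hxpq⟩ := (Set.Infinite.sdiff hinf (toFinite {p, q})).nonempty
  obtain ⟨y, hy, hyx⟩ := (Set.Infinite.sdiff hinf (toFinite {x})).nonempty
  have hxy : LinearIndependent ℝ ![(x : ℝ³), (y : ℝ³)] :=
    linearIndependent_pair (Ne.symm hyx) (ne_neg_of_mem_arc hp hp' hx.1 hy.1)
  refine hne (h.eq_of_coplanar hu hu' ?_ hx (by simpa using hxpq))
  rw [← span_pair_eq_of_mem (mem_span_of_mem_arc hx.1) (mem_span_of_mem_arc hy.1) hxy,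
    span_pair_eq_of_mem (mem_span_of_mem_arc hx.2) (mem_span_of_mem_arc hy.2) hxy]

end Sphere

section GenericVector

variable {E : Type*} [NormedAddCommGroup E] [NormedSpace ℝ E]

lemma exists_forall_notMem_submodule [FiniteDimensional ℝ E] {𝒲 : Set (Submodule ℝ E)}
    (h𝒲 : 𝒲.Finite) (hproper : ∀ W ∈ 𝒲, W ≠ ⊤) {U : Set (Metric.sphere (0 : E) 1)}
    (hU : IsOpen U) (hne : U.Nonempty) : ∃ c ∈ U, ∀ W ∈ 𝒲, (c : E) ∉ W := by
  have hdense : Dense (⋂ W ∈ 𝒲, (W : Set E)ᶜ) := by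
    refine dense_biInter_of_isOpen (fun W _ => W.closed_of_finiteDimensional.isOpen_compl)
      h𝒲.countable fun W hW => ?_
    rw [← interior_eq_empty_iff_dense_compl]
    by_contra h
    exact hproper W hW (W.eq_top_of_nonempty_interior' (nonempty_iff_ne_empty.mpr h))
  let radial : ({0}ᶜ : Set E) → Metric.sphere (0 : E) 1 := fun x => (homeomorphUnitSphereProd E x).1
  have hcone : IsOpen (Subtype.val '' (radial ⁻¹' U)) :=
    isOpen_compl_singleton.isOpenMap_subtype_val _ (hU.preimage (by fun_prop))
  have hcone_ne : (Subtype.val '' (radial ⁻¹' U)).Nonempty := by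
    obtain ⟨c, hc⟩ := hne
    refine ⟨c, ⟨c, ne_zero_of_mem_unit_sphere c⟩, ?_, rfl⟩
    have : radial ⟨c, ne_zero_of_mem_unit_sphere c⟩ = c := Subtype.ext (by simp [radial])
    simpa [this]
  obtain ⟨-, ⟨x, hx, rfl⟩, hxW⟩ := hdense.inter_open_nonempty _ hcone hcone_ne
  refine ⟨radial x, hx, fun W hW hmem => mem_iInter₂.mp hxW W hW ?_⟩
  exact (W.smul_mem_iff (inv_ne_zero (norm_ne_zero_iff.mpr x.2))).mp (by simpa [radial] using hmem)

end GenericVector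

namespace Diagram

variable {K : Diagram} {p q x c P Q : S2} {e f : Sym2 S2}

lemma meetGenerically (he : e ∈ K.edges) (hf : f ∈ K.edges) : MeetGenerically e f := by
  rcases eq_or_ne e f with rfl | hef
  · exact fun _ _ => Iff.rfl
  · exact K.generic e he f hf hef

lemma finite_arc_inter_arc (he : e ∈ K.edges) (hf : f ∈ K.edges) (hef : e ≠ f) :
    (arc e ∩ arc f).Finite := by
  induction e with | _ p q
  induction f with | _ u v
  obtain ⟨hp, hp'⟩ := K.nondegenerate p q he
  obtain ⟨hu, hu'⟩ := K.nondegenerate u v hf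
  exact (meetGenerically he hf).finite_inter hp hp' hu hu' hef

/-- The end vertices of the edges. -/
def vertices (K : Diagram) : Set S2 := {x | ∃ e ∈ K.edges, x ∈ e}

/-- The points on two different edges: the crossings and the common vertices of two edges. -/
def doublePoints (K : Diagram) : Set S2 :=
  {x | ∃ e ∈ K.edges, ∃ f ∈ K.edges, e ≠ f ∧ x ∈ arc e ∩ arc f}

lemma finite_vertices (K : Diagram) : K.vertices.Finite := by
  have h : K.vertices = ⋃ e ∈ K.edges, {x | x ∈ e} := by ext; simp [vertices]
  rw [h]
  refine K.finite_edges.biUnion fun e _ => ?_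
  induction e with | _ p q
  exact (toFinite {p, q}).subset fun x => by simp

lemma finite_doublePoints (K : Diagram) : K.doublePoints.Finite := by
  have h : K.doublePoints ⊆ ⋃ i ∈ K.edges.offDiag, arc i.1 ∩ arc i.2 := by
    rintro x ⟨e, he, f, hf, hef, hx⟩
    exact mem_biUnion (x := (e, f)) ⟨he, hf, hef⟩ hx
  exact (K.finite_edges.offDiag.biUnion fun i hi =>
    finite_arc_inter_arc hi.1 hi.2.1 hi.2.2).subset h

/-- The point `c` lies on no great circle through two vertices or double points of `K`. -/
def GenericPoint (K : Diagram) (c : S2) : Prop :=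
  ∀ x ∈ K.vertices ∪ K.doublePoints, ∀ y ∈ K.vertices ∪ K.doublePoints,
    (c : ℝ³) ∉ span ℝ {(x : ℝ³), (y : ℝ³)}

lemma exists_genericPoint (K K' : Diagram) {U : Set S2} (hU : IsOpen U) (hne : U.Nonempty) :
    ∃ c ∈ U, K.GenericPoint c ∧ K'.GenericPoint c := by
  have hfin (M : Diagram) : (M.vertices ∪ M.doublePoints).Finite :=
    M.finite_vertices.union M.finite_doublePoints
  let planes (M : Diagram) : Set (Submodule ℝ ℝ³) :=
    image2 (fun x y : S2 => span ℝ {(x : ℝ³), (y : ℝ³)}) (M.vertices ∪ M.doublePoints)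
      (M.vertices ∪ M.doublePoints)
  have hproper : ∀ W ∈ planes K ∪ planes K', W ≠ ⊤ := by
    rintro W (⟨x, -, y, -, rfl⟩ | ⟨x, -, y, -, rfl⟩) <;> exact span_pair_ne_top (by simp) _ _
  obtain ⟨c, hcU, hc⟩ := exists_forall_notMem_submodule
    (((hfin K).image2 _ (hfin K)).union ((hfin K').image2 _ (hfin K'))) hproper hU hne
  exact ⟨c, hcU, fun x hx y hy => hc _ (.inl (mem_image2_of_mem hx hy)),
    fun x hx y hy => hc _ (.inr (mem_image2_of_mem hx hy))⟩

lemma mem_of_mem_arc (he : e ∈ K.edges) (hx : x ∈ K.vertices) (hxe : x ∈ arc e) : x ∈ e := by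
  obtain ⟨f, hf, hxf⟩ := hx
  exact (meetGenerically hf he x ⟨mem_arc_of_mem hxf, hxe⟩).mp hxf

lemma endpoints_subset_vertices (K : Diagram) : K.endpoints ⊆ K.vertices :=
  fun _ ⟨e, he, _⟩ => ⟨e, he⟩

lemma notMem_doublePoints_of_mem_endpoints (hP : P ∈ K.endpoints) : P ∉ K.doublePoints :=
  fun ⟨_, he, _, hf, hef, hPe, hPf⟩ =>
    have hPv := K.endpoints_subset_vertices hP
    hef (hP.unique ⟨he, mem_of_mem_arc he hPv hPe⟩ ⟨hf, mem_of_mem_arc hf hPv hPf⟩)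

namespace GenericPoint

variable (hc : K.GenericPoint c)

include hc

lemma notMem_arc (he : e ∈ K.edges) : c ∉ arc e := by
  induction e with | _ p q
  exact fun h => hc p (.inl ⟨_, he, Sym2.mem_mk_left p q⟩) q (.inl ⟨_, he, Sym2.mem_mk_right p q⟩)
    (mem_span_of_mem_arc h)

lemma eq_of_mem_arc (hP : P ∈ K.vertices) (hx : x ∈ K.vertices ∪ K.doublePoints)
    (hxP : x ∈ arc s(P, c)) : x = P := by
  obtain ⟨a, b, ha, -, hab⟩ := mem_arc_mk.mp hxP
  have hb : b = 0 := by
    by_contra hb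
    refine hc x hx P (.inl hP) ((smul_mem_iff _ hb).mp (mem_span_pair.mpr ⟨1, -a, ?_⟩))
    rw [hab]
    module
  exact eq_of_coe_eq_smul ha (by simpa [hb] using hab)

lemma ne (hP : P ∈ K.vertices) : P ≠ c := by
  rintro rfl
  exact hc P (.inl hP) P (.inl hP) (subset_span (mem_insert _ _))

lemma eq_of_mem_arc_of_mem_arc (hP : P ∈ K.vertices) (hQ : Q ∈ K.vertices) (hPQ : P ≠ Q)
    (hxP : x ∈ arc s(P, c)) (hxQ : x ∈ arc s(Q, c)) : x = c := by
  obtain ⟨a, b, ha, hb, hab⟩ := mem_arc_mk.mp hxP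
  obtain ⟨a', b', ha', -, hab'⟩ := mem_arc_mk.mp hxQ
  have hbb' : b - b' = 0 := by
    by_contra hbb'
    refine hc P (.inl hP) Q (.inl hQ) ((smul_mem_iff _ hbb').mp (mem_span_pair.mpr ⟨-a, a', ?_⟩))
    linear_combination (norm := module) hab - hab'
  have haa' : a • (P : ℝ³) = a' • (Q : ℝ³) := by
    linear_combination (norm := module) hab' - hab - hbb' • (c : ℝ³)
  have ha0 : a = 0 := by
    by_contra ha0
    refine hPQ (eq_of_coe_eq_smul (a := a⁻¹ * a') (by positivity) ?_)
    rw [mul_smul, ← haa', inv_smul_smul₀ ha0]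
  exact eq_of_coe_eq_smul hb (by simpa [ha0] using hab)

end GenericPoint

variable {M M' : Diagram} {A B C : Set (Sym2 S2)}

/-- The number of edges of `E` that end in `x`. -/
noncomputable def valence (E : Set (Sym2 S2)) (x : S2) : ℕ := {e ∈ E | x ∈ e}.ncard

lemma valence_union (hA : A.Finite) (hB : B.Finite) (hAB : Disjoint A B) (x : S2) :
    valence (A ∪ B) x = valence A x + valence B x := by
  have hunion : {e ∈ A ∪ B | x ∈ e} = {e ∈ A | x ∈ e} ∪ {e ∈ B | x ∈ e} :=
    sep_union
  rw [valence, hunion, ncard_union_eq (hAB.mono (sep_subset _ _) (sep_subset _ _))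
    (hA.subset (sep_subset _ _)) (hB.subset (sep_subset _ _)), valence, valence]

lemma mem_endpoints_iff : x ∈ K.endpoints ↔ valence K.edges x = 1 := by
  simp only [valence, ncard_eq_one, endpoints, ExistsUnique, eq_singleton_iff_unique_mem]
  rfl

lemma valence_edges_le_two (K : Diagram) (x : S2) : valence K.edges x ≤ 2 := by
  by_contra! h
  obtain ⟨e, f, g, he, hf, hg, hef, heg, hfg⟩ :=
    (two_lt_ncard_iff (K.finite_edges.subset (sep_subset _ _))).mp h
  exact (K.no_triple e he.1 f hf.1 g hg.1 hef hfg heg).subset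
    ⟨⟨mem_arc_of_mem he.2, mem_arc_of_mem hf.2⟩, mem_arc_of_mem hg.2⟩

lemma mem_endpoints_iff_odd : x ∈ K.endpoints ↔ Odd (valence K.edges x) := by
  have h := K.valence_edges_le_two x
  rw [mem_endpoints_iff]
  interval_cases valence K.edges x <;> simp

lemma IsPathBetween.odd_valence_iff (hA : IsPathBetween A p q) (hpq : p ≠ q) :
    Odd (valence A x) ↔ x ∈ ({p, q} : Set S2) := by
  classical
  obtain ⟨w, hw, hwA⟩ := hA
  have hcount : valence A x = w.edges.countP (x ∈ ·) := by
    have hset : {e ∈ A | x ∈ e} = (w.edges.filter (x ∈ ·)).toFinset := by ext; simp [← hwA]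
    rw [valence, hset, ncard_coe_finset,
      List.toFinset_card_of_nodup (hw.isTrail.edges_nodup.filter _), List.countP_eq_length_filter]
  rw [hcount, ← Nat.not_even_iff_odd, hw.isTrail.even_countP_edges_iff]
  simp [hpq, or_iff_not_imp_left]

lemma IsPathBetween.finite (hA : IsPathBetween A p q) : A.Finite := by
  obtain ⟨w, -, hwA⟩ := hA
  exact hwA ▸ w.edges.finite_toSet

lemma endpoints_eq_symmDiff (hA : IsPathBetween A p q) (hpq : p ≠ q) (hKA : Disjoint K.edges A)
    (hM : M.edges = K.edges ∪ A) : M.endpoints = symmDiff K.endpoints {p, q} := by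
  ext x
  rw [mem_endpoints_iff_odd, hM, valence_union K.finite_edges hA.finite hKA, Nat.odd_add',
    Set.mem_symmDiff, ← hA.odd_valence_iff hpq, mem_endpoints_iff_odd,
    ← Nat.not_odd_iff_even]
  tauto

lemma endpoints_eq_of_replace_path (hA : IsPathBetween A p q) (hB : IsPathBetween B p q)
    (hpq : p ≠ q) (hCA : Disjoint C A) (hCB : Disjoint C B) (hM : M.edges = C ∪ A)
    (hM' : M'.edges = C ∪ B) : M.endpoints = M'.endpoints := by
  have hC : C.Finite := M.finite_edges.subset (hM ▸ subset_union_left)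
  ext x
  simp only [mem_endpoints_iff_odd, hM, hM', valence_union hC hA.finite hCA,
    valence_union hC hB.finite hCB, Nat.odd_add', hA.odd_valence_iff hpq, hB.odd_valence_iff hpq]

lemma isPathBetween_singleton (hpq : p ≠ q) : IsPathBetween {s(p, q)} p q := by
  have hadj : (SimpleGraph.fromEdgeSet {s(p, q)}).Adj p q := by simp [hpq]
  exact ⟨.cons hadj .nil, by simpa using hpq, by ext; simp⟩

lemma IsPathBetween.symm (hA : IsPathBetween A p q) : IsPathBetween A q p := by
  obtain ⟨w, hw, hwA⟩ := hA
  exact ⟨w.reverse, hw.reverse, by simpa using hwA⟩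

lemma IsPathBetween.nonempty (hA : IsPathBetween A p q) (hpq : p ≠ q) : A.Nonempty := by
  obtain ⟨w, -, hwA⟩ := hA
  cases w with
  | nil => exact absurd rfl hpq
  | @cons _ v _ h w => exact ⟨s(p, v), hwA.subset (by simp)⟩

lemma IsPathBetween.cons (hA : IsPathBetween A c q) (hpc : p ≠ c) (hpq : p ≠ q)
    (hp : ∀ e ∈ A, p ∉ e) : IsPathBetween (insert s(p, c) A) p q := by
  obtain ⟨w, hw, hwA⟩ := hA
  have hadj : (SimpleGraph.fromEdgeSet (insert s(p, c) A)).Adj p c := by simp [hpc]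
  have hle : SimpleGraph.fromEdgeSet A ≤ SimpleGraph.fromEdgeSet (insert s(p, c) A) :=
    SimpleGraph.fromEdgeSet_mono (subset_insert _ _)
  refine ⟨.cons hadj (w.mapLe hle), (SimpleGraph.Walk.cons_isPath_iff _ _).mpr
    ⟨hw.mapLe hle, ?_⟩, ?_⟩
  · rw [SimpleGraph.Walk.support_mapLe_eq_support,
      SimpleGraph.Walk.mem_support_iff_exists_mem_edges]
    rintro (hpq' | ⟨e, he, hpe⟩)
    · exact hpq hpq'
    · exact hp e (hwA.subset he) hpe
  · ext e
    simp [← hwA]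

lemma isPathBetween_pair (hpq : p ≠ q) (hp : p ≠ c) (hq : q ≠ c) :
    IsPathBetween {s(p, c), s(q, c)} p q := by
  rw [Sym2.eq_swap (a := q)]
  exact (isPathBetween_singleton hq.symm).cons hp hpq (by simp [hp, hpq])

/-- A new edge `pq` may be added to `K` with only virtual crossings. -/
structure IsTransverse (K : Diagram) (p q : S2) : Prop where
  ne : p ≠ q
  ne_neg : p ≠ -q
  meetGenerically : ∀ e ∈ K.edges, MeetGenerically s(p, q) e
  disjoint_doublePoints : Disjoint (arc s(p, q)) K.doublePoints

/-- `K` with one more edge, all of whose crossings are virtual. -/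
def addEdge (K : Diagram) (p q : S2) (h : K.IsTransverse p q) : Diagram where
  edges := insert s(p, q) K.edges
  finite_edges := K.finite_edges.insert _
  nondegenerate := by
    rintro u v (huv | huv)
    · rcases Sym2.eq_iff.mp huv with ⟨rfl, rfl⟩ | ⟨rfl, rfl⟩
      · exact ⟨h.ne, h.ne_neg⟩
      · exact ⟨h.ne.symm, fun huv => h.ne_neg (by rw [huv, neg_neg])⟩
    · exact K.nondegenerate u v huv
  generic := by
    rintro e (rfl | he) f (rfl | hf) hef
    · exact absurd rfl hef
    · exact h.meetGenerically f hf
    · exact (h.meetGenerically e he).symm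
    · exact K.generic e he f hf hef
  no_triple := by
    have hdisj {f g : Sym2 S2} (hf : f ∈ K.edges) (hg : g ∈ K.edges) (hfg : f ≠ g) {x : S2}
        (hx : x ∈ arc s(p, q)) (hxf : x ∈ arc f) (hxg : x ∈ arc g) : False :=
      h.disjoint_doublePoints.ne_of_mem hx ⟨f, hf, g, hg, hfg, hxf, hxg⟩ rfl
    intro e he f hf g hg hef hfg heg
    refine eq_empty_of_forall_notMem fun x ⟨⟨hxe, hxf⟩, hxg⟩ => ?_
    rcases he with rfl | he
    · exact hdisj (hf.resolve_left hef.symm) (hg.resolve_left heg.symm) hfg hxe hxf hxg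
    rcases hf with rfl | hf
    · exact hdisj he (hg.resolve_left hfg.symm) heg hxf hxe hxg
    rcases hg with rfl | hg
    · exact hdisj he hf hef hxg hxe hxf
    · exact (K.no_triple e he f hf g hg hef hfg heg).subset ⟨⟨hxe, hxf⟩, hxg⟩
  isOver := K.isOver
  crosses_of_isOver := fun e f hef =>
    have ⟨he, hf, hcross⟩ := K.crosses_of_isOver e f hef
    ⟨.inr he, .inr hf, hcross⟩
  isOver_asymm := K.isOver_asymm

lemma GenericPoint.isTransverse (hc : K.GenericPoint c) (hP : P ∈ K.endpoints) :
    K.IsTransverse P c where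
  ne := hc.ne (K.endpoints_subset_vertices hP)
  ne_neg := by
    rintro rfl
    have hcP := K.endpoints_subset_vertices hP
    refine hc _ (.inl hcP) _ (.inl hcP) (mem_span_pair.mpr ⟨-1, 0, ?_⟩)
    simp
  meetGenerically e he x := by
    rintro ⟨hx, hxe⟩
    have hPv := K.endpoints_subset_vertices hP
    refine ⟨fun hxP => ?_, fun hxe' => ?_⟩
    · rcases Sym2.mem_iff.mp hxP with rfl | rfl
      · exact mem_of_mem_arc he hPv hxe
      · exact absurd hxe (hc.notMem_arc he)
    · exact hc.eq_of_mem_arc hPv (.inl ⟨e, he, hxe'⟩) hx ▸ Sym2.mem_mk_left P c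
  disjoint_doublePoints := disjoint_left.mpr fun x hx hxd =>
    notMem_doublePoints_of_mem_endpoints hP
      (hc.eq_of_mem_arc (K.endpoints_subset_vertices hP) (.inr hxd) hx ▸ hxd)

lemma GenericPoint.isTransverse_addEdge (hc : K.GenericPoint c) (hP : P ∈ K.endpoints)
    (hQ : Q ∈ K.endpoints) (hPQ : P ≠ Q) :
    (K.addEdge P c (hc.isTransverse hP)).IsTransverse Q c where
  ne := hc.ne (K.endpoints_subset_vertices hQ)
  ne_neg := (hc.isTransverse hQ).ne_neg
  meetGenerically := by
    have hPv := K.endpoints_subset_vertices hP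
    have hQv := K.endpoints_subset_vertices hQ
    rintro e (rfl | he) x hx
    · simp [hc.eq_of_mem_arc_of_mem_arc hQv hPv hPQ.symm hx.1 hx.2]
    · exact (hc.isTransverse hQ).meetGenerically e he x hx
  disjoint_doublePoints := by
    have hPv := K.endpoints_subset_vertices hP
    have hQv := K.endpoints_subset_vertices hQ
    have hdisj {g : Sym2 S2} (hg : g ∈ K.edges) {x : S2} (hxQ : x ∈ arc s(Q, c))
        (hxP : x ∈ arc s(P, c)) (hxg : x ∈ arc g) : False :=
      hc.notMem_arc hg (hc.eq_of_mem_arc_of_mem_arc hPv hQv hPQ hxP hxQ ▸ hxg)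
    rw [disjoint_left]
    rintro x hx ⟨e, rfl | he, f, rfl | hf, hef, hxe, hxf⟩
    · exact hef rfl
    · exact hdisj hf hx hxe hxf
    · exact hdisj he hx hxf hxe
    · exact (hc.isTransverse hQ).disjoint_doublePoints.ne_of_mem hx
        ⟨e, he, f, hf, hef, hxe, hxf⟩ rfl

/-- `K` with the endpoints `P` and `Q` joined through the point `c` by a path of two edges, all of
whose crossings are virtual. -/
def addPath (K : Diagram) (hP : P ∈ K.endpoints) (hQ : Q ∈ K.endpoints) (hPQ : P ≠ Q)
    (hc : K.GenericPoint c) : Diagram :=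
  (K.addEdge P c (hc.isTransverse hP)).addEdge Q c (hc.isTransverse_addEdge hP hQ hPQ)

lemma edges_addPath (hP : P ∈ K.endpoints) (hQ : Q ∈ K.endpoints) (hPQ : P ≠ Q)
    (hc : K.GenericPoint c) : (K.addPath hP hQ hPQ hc).edges = K.edges ∪ {s(P, c), s(Q, c)} := by
  rw [pair_comm, union_insert, union_singleton]
  rfl

lemma GenericPoint.notMem_edges (hc : K.GenericPoint c) (P : S2) : s(P, c) ∉ K.edges :=
  fun h => hc.notMem_arc h (right_mem_arc P c)

/-- The part of `D` formed by a set of edges that contains all classical crossings. -/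
def restrict (D : Diagram) (E : Set (Sym2 S2)) (hE : E ⊆ D.edges)
    (hover : ∀ e f, D.isOver e f → e ∈ E ∧ f ∈ E) : Diagram where
  edges := E
  finite_edges := D.finite_edges.subset hE
  nondegenerate p q h := D.nondegenerate p q (hE h)
  generic e he f hf := D.generic e (hE he) f (hE hf)
  no_triple e he f hf g hg := D.no_triple e (hE he) f (hE hf) g (hE hg)
  isOver := D.isOver
  crosses_of_isOver e f h :=
    ⟨(hover e f h).1, (hover e f h).2, (D.crosses_of_isOver e f h).2.2⟩
  isOver_asymm := D.isOver_asymm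

end Diagram

attribute [ext] VirtualLinkDiagram

open Diagram

section PartialClosure

variable {ι : Type*} {σ : Equiv.Perm ι} {l l' : ι → S2} {A : ι → Set (Sym2 S2)} {i j : ι}
  {B E E' : Set (Sym2 S2)} {K D : Diagram} {c : S2}

open scoped Classical in
/-- The family `A` of closure arcs with the arc between `i` and `σ i` replaced by `B`. -/
noncomputable def replaceArc (σ : Equiv.Perm ι) (A : ι → Set (Sym2 S2)) (i : ι)
    (B : Set (Sym2 S2)) : ι → Set (Sym2 S2) :=
  ({i, σ i} : Set ι).piecewise (fun _ => B) A

lemma replaceArc_of_mem (hj : j = i ∨ j = σ i) : replaceArc σ A i B j = B := by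
  classical exact piecewise_eq_of_mem _ _ _ hj

lemma replaceArc_of_notMem (hj : ¬(j = i ∨ j = σ i)) : replaceArc σ A i B j = A j := by
  classical exact piecewise_eq_of_notMem _ _ _ hj

lemma replaceArc_self (hA : A (σ i) = A i) : replaceArc σ A i (A i) = A := by
  ext1 j
  by_cases hj : j = i ∨ j = σ i
  · rw [replaceArc_of_mem hj]
    rcases hj with rfl | rfl <;> simp only [hA]
  · rw [replaceArc_of_notMem hj]

lemma replaceArc_replaceArc (B' : Set (Sym2 S2)) :
    replaceArc σ (replaceArc σ A i B) i B' = replaceArc σ A i B' := by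
  ext1 j
  by_cases hj : j = i ∨ j = σ i
  · rw [replaceArc_of_mem hj, replaceArc_of_mem hj]
  · rw [replaceArc_of_notMem hj, replaceArc_of_notMem hj, replaceArc_of_notMem hj]

@[elab_as_elim]
lemma replaceArc_induction {P : Set (Sym2 S2) → Prop} (hB : P B)
    (hA : ¬(j = i ∨ j = σ i) → P (A j)) : P (replaceArc σ A i B j) := by
  by_cases hj : j = i ∨ j = σ i
  · rwa [replaceArc_of_mem hj]
  · rw [replaceArc_of_notMem hj]
    exact hA hj

lemma iUnion_replaceArc :
    ⋃ j, replaceArc σ A i B j = (⋃ j, replaceArc σ A i ∅ j) ∪ B := by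
  refine subset_antisymm (iUnion_subset fun j => ?_) (union_subset (iUnion_mono fun j => ?_) ?_)
  · by_cases hj : j = i ∨ j = σ i
    · rw [replaceArc_of_mem hj]
      exact subset_union_right
    · rw [replaceArc_of_notMem hj, ← replaceArc_of_notMem (A := A) (B := ∅) hj]
      exact subset_union_of_subset_left (subset_iUnion _ j) _
  · by_cases hj : j = i ∨ j = σ i
    · simp only [replaceArc_of_mem hj, empty_subset]
    · simp only [replaceArc_of_notMem hj, subset_rfl]
  · exact subset_iUnion_of_subset i (replaceArc_of_mem (.inl rfl)).superset

/-- Pairwise disjoint paths `A i`, disjoint from `E`, from `l i` to `l (σ i)`. An empty `A i` means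
that the endpoints `l i` and `l (σ i)` have not been joined. -/
structure IsArcSystem (E : Set (Sym2 S2)) (l : ι → S2) (σ : Equiv.Perm ι)
    (A : ι → Set (Sym2 S2)) : Prop where
  isPathBetween : ∀ i, (A i).Nonempty → IsPathBetween (A i) (l i) (l (σ i))
  apply_perm : ∀ i, A (σ i) = A i
  disjoint : ∀ i j, j ≠ i → j ≠ σ i → Disjoint (A i) (A j)
  disjoint_edges : ∀ i, Disjoint E (A i)

lemma IsArcSystem.replaceArc (hσ : ∀ i, σ (σ i) = i) (h : IsArcSystem E l σ A)
    (hl : ∀ j, ¬(j = i ∨ j = σ i) → l' j = l j) (hE : E' ⊆ E)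
    (hB : B.Nonempty → IsPathBetween B (l' i) (l' (σ i))) (hEB : Disjoint E' B)
    (hAB : ∀ j, ¬(j = i ∨ j = σ i) → Disjoint (A j) B) :
    IsArcSystem E' l' σ (replaceArc σ A i B) := by
  have hperm {j : ι} : σ j = i ∨ σ j = σ i ↔ j = i ∨ j = σ i := by
    rw [σ.injective.eq_iff, or_comm, ← σ.injective.eq_iff (a := σ j), hσ]
  refine ⟨fun j hj => ?_, fun j => ?_, fun j k hkj hkσj => ?_, fun j => ?_⟩
  · by_cases hji : j = i ∨ j = σ i
    · rw [replaceArc_of_mem hji] at hj ⊢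
      rcases hji with rfl | rfl
      · exact hB hj
      · rw [hσ]
        exact (hB hj).symm
    · rw [replaceArc_of_notMem hji] at hj ⊢
      rw [hl j hji, hl (σ j) (hperm.not.mpr hji)]
      exact h.isPathBetween j hj
  · by_cases hji : j = i ∨ j = σ i
    · rw [replaceArc_of_mem hji, replaceArc_of_mem (hperm.mpr hji)]
    · rw [replaceArc_of_notMem hji, replaceArc_of_notMem (hperm.not.mpr hji), h.apply_perm]
  · by_cases hji : j = i ∨ j = σ i <;> by_cases hki : k = i ∨ k = σ i
    · rcases hji with rfl | rfl <;> rcases hki with rfl | rfl <;> simp_all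
    · rw [replaceArc_of_mem hji, replaceArc_of_notMem hki]
      exact (hAB k hki).symm
    · rw [replaceArc_of_mem hki, replaceArc_of_notMem hji]
      exact hAB j hji
    · rw [replaceArc_of_notMem hji, replaceArc_of_notMem hki]
      exact h.disjoint j k hkj hkσj
  · by_cases hji : j = i ∨ j = σ i
    · rwa [replaceArc_of_mem hji]
    · rw [replaceArc_of_notMem hji]
      exact (h.disjoint_edges j).mono_left hE

/-- `D` arises from `K` by joining some of the endpoints `l i` and `l (σ i)` by the closure arcs
`A i`. -/
structure IsPartialClosure (K : Diagram) (l : ι → S2) (σ : Equiv.Perm ι)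
    (A : ι → Set (Sym2 S2)) (D : Diagram) : Prop extends IsArcSystem K.edges l σ A where
  edges_eq : D.edges = K.edges ∪ ⋃ i, A i
  isOver_iff : ∀ e f, D.isOver e f ↔ K.isOver e f
  endpoints_eq : D.endpoints = l '' {i | A i = ∅}

lemma isPartialClosure_self (hK : K.endpoints = range l) :
    IsPartialClosure K l σ (fun _ => ∅) K where
  isPathBetween _ h := absurd h not_nonempty_empty
  apply_perm _ := rfl
  disjoint _ _ _ _ := disjoint_empty _
  disjoint_edges _ := disjoint_empty _
  edges_eq := by simp
  isOver_iff _ _ := Iff.rfl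
  endpoints_eq := by simpa using hK

lemma setOf_replaceArc_eq_empty (hA : A (σ i) = A i) (hB : B = ∅ ↔ (A i).Nonempty) :
    {j | replaceArc σ A i B j = ∅} = symmDiff {j | A j = ∅} {i, σ i} := by
  ext j
  by_cases hj : j = i ∨ j = σ i
  · have hAj : A j = A i := by rcases hj with rfl | rfl <;> simp only [hA]
    simp [Set.mem_symmDiff, replaceArc_of_mem hj, hj, hAj, hB, nonempty_iff_ne_empty]
  · simp [Set.mem_symmDiff, replaceArc_of_notMem hj, hj]

namespace IsPartialClosure

variable (h : IsPartialClosure K l σ A D)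

include h

lemma endpoints_eq_empty (hA : ∀ i, (A i).Nonempty) : D.endpoints = ∅ := by
  simp [h.endpoints_eq, fun i => (hA i).ne_empty]

lemma edges_subset : K.edges ⊆ D.edges := h.edges_eq ▸ subset_union_left

lemma arc_subset (i : ι) : A i ⊆ D.edges :=
  h.edges_eq ▸ subset_union_of_subset_right (subset_iUnion A i) _

lemma exists_addArc (hσ : ∀ i, σ (σ i) = i ∧ σ i ≠ i) (hl : l.Injective) (hi : A i = ∅)
    (hc : D.GenericPoint c) :
    ∃ D', IsPartialClosure K l σ (replaceArc σ A i {s(l i, c), s(l (σ i), c)}) D' ∧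
      Disjoint D.edges {s(l i, c), s(l (σ i), c)} ∧
      D'.edges = D.edges ∪ {s(l i, c), s(l (σ i), c)} := by
  have hmem {j : ι} (hj : A j = ∅) : l j ∈ D.endpoints := h.endpoints_eq ▸ mem_image_of_mem l hj
  have hP : l i ∈ D.endpoints := hmem hi
  have hQ : l (σ i) ∈ D.endpoints := hmem (h.apply_perm i ▸ hi)
  have hPQ : l i ≠ l (σ i) := hl.ne (hσ i).2.symm
  set B : Set (Sym2 S2) := {s(l i, c), s(l (σ i), c)}
  have hB : IsPathBetween B (l i) (l (σ i)) :=
    isPathBetween_pair hPQ (hc.isTransverse hP).ne (hc.isTransverse hQ).ne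
  have hDB : Disjoint D.edges B := by
    simp [B, disjoint_insert_right, hc.notMem_edges]
  have hedges := edges_addPath hP hQ hPQ hc
  refine ⟨D.addPath hP hQ hPQ hc, { h.toIsArcSystem.replaceArc (fun i => (hσ i).1)
    (fun _ _ => rfl) subset_rfl (fun _ => hB) (hDB.mono_left h.edges_subset)
    (fun j _ => hDB.mono_left (h.arc_subset j)) with
    edges_eq := ?_
    isOver_iff := h.isOver_iff
    endpoints_eq := ?_ }, hDB, hedges⟩
  · have hself : replaceArc σ A i ∅ = A := hi ▸ replaceArc_self (h.apply_perm i)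
    rw [hedges, h.edges_eq, iUnion_replaceArc, hself, union_assoc]
  · rw [endpoints_eq_symmDiff hB hPQ hDB hedges, h.endpoints_eq,
      setOf_replaceArc_eq_empty (h.apply_perm i) (by simp [hi, (hB.nonempty hPQ).ne_empty]),
      image_symmDiff hl, image_pair]

lemma exists_removeArc (hσ : ∀ i, σ (σ i) = i ∧ σ i ≠ i) (hl : l.Injective) (hi : (A i).Nonempty) :
    ∃ R, IsPartialClosure K l σ (replaceArc σ A i ∅) R ∧
      Disjoint R.edges (A i) ∧ D.edges = R.edges ∪ A i := by
  have hsplit : D.edges = (K.edges ∪ ⋃ j, replaceArc σ A i ∅ j) ∪ A i := by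
    rw [h.edges_eq, union_assoc, ← iUnion_replaceArc, replaceArc_self (h.apply_perm i)]
  have hdisj : Disjoint (K.edges ∪ ⋃ j, replaceArc σ A i ∅ j) (A i) := by
    refine disjoint_union_left.mpr ⟨h.disjoint_edges i, disjoint_iUnion_left.mpr fun j => ?_⟩
    by_cases hj : j = i ∨ j = σ i
    · simp [replaceArc_of_mem hj]
    · rw [replaceArc_of_notMem hj]
      exact (h.disjoint i j (not_or.mp hj).1 (not_or.mp hj).2).symm
  let R := D.restrict _ (hsplit ▸ subset_union_left) fun e f hef =>
    have ⟨he, hf, _⟩ := K.crosses_of_isOver e f ((h.isOver_iff e f).mp hef)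
    ⟨.inl he, .inl hf⟩
  have hendpoints : D.endpoints = symmDiff R.endpoints {l i, l (σ i)} :=
    endpoints_eq_symmDiff (h.isPathBetween i hi) (hl.ne (hσ i).2.symm) hdisj hsplit
  refine ⟨R, { h.toIsArcSystem.replaceArc (fun i => (hσ i).1) (fun _ _ => rfl) subset_rfl
    (fun h => absurd h not_nonempty_empty) (disjoint_empty _) (fun _ _ => disjoint_empty _) with
    edges_eq := rfl
    isOver_iff := h.isOver_iff
    endpoints_eq := ?_ }, hdisj, hsplit⟩
  rw [setOf_replaceArc_eq_empty (h.apply_perm i) (by simp [hi]), image_symmDiff hl, image_pair,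
    ← h.endpoints_eq, hendpoints, symmDiff_symmDiff_cancel_right]

end IsPartialClosure

end PartialClosure

lemma VirtualMove.toLink_eq {D D' : VirtualLinkDiagram} (h : VirtualMove D D') :
    D.toLink = D'.toLink :=
  Quotient.sound (.rel _ _ h)

section Closure

variable {ι : Type*} {σ : Equiv.Perm ι} {l : ι → S2} {A A' : ι → Set (Sym2 S2)}
  {K K' : Diagram} {D D' : VirtualLinkDiagram} {U : Set S2}

/-- The diagram `R` does not depend on `c`, so that one point `c` can serve two closures. -/
lemma IsPartialClosure.exists_detour (hσ : ∀ i, σ (σ i) = i ∧ σ i ≠ i) (hl : l.Injective)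
    (h : IsPartialClosure K l σ A D.toDiagram) (hA : ∀ j, (A j).Nonempty) (i : ι) :
    ∃ R : Diagram, ∀ c, R.GenericPoint c → ∃ D' : VirtualLinkDiagram, D.toLink = D'.toLink ∧
      IsPartialClosure K l σ (replaceArc σ A i {s(l i, c), s(l (σ i), c)}) D'.toDiagram := by
  obtain ⟨R, hR, hRA, hD⟩ := h.exists_removeArc hσ hl (hA i)
  refine ⟨R, fun c hc => ?_⟩
  obtain ⟨M, hM, hRB, hM_edges⟩ := hR.exists_addArc hσ hl (replaceArc_of_mem (.inl rfl)) hc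
  rw [replaceArc_replaceArc] at hM
  have hB := hM.isPathBetween i (replaceArc_induction (insert_nonempty _ _) fun _ => hA i)
  rw [replaceArc_of_mem (.inl rfl)] at hB
  let D' : VirtualLinkDiagram := ⟨M, hM.endpoints_eq_empty fun j =>
    replaceArc_induction (insert_nonempty _ _) fun _ => hA j⟩
  have hdetour : D.toDiagram.Detour D'.toDiagram :=
    ⟨R.edges, A i, _, l i, l (σ i), hRA, hRB, hD, hM_edges, h.isPathBetween i (hA i), hB,
      fun e f hef =>
        have ⟨he, hf, _⟩ := K.crosses_of_isOver e f ((h.isOver_iff e f).mp hef)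
        ⟨hR.edges_subset he, hR.edges_subset hf⟩,
      fun e f => (hM.isOver_iff e f).trans (h.isOver_iff e f).symm⟩
  exact ⟨D', VirtualMove.toLink_eq (.inr (.inr (.inr (.inr hdetour)))), hM⟩

lemma IsPartialClosure.toLink_eq [Finite ι] (hσ : ∀ i, σ (σ i) = i ∧ σ i ≠ i) (hl : l.Injective)
    (h : IsPartialClosure K l σ A D.toDiagram) (hA : ∀ i, (A i).Nonempty)
    (h' : IsPartialClosure K l σ A' D'.toDiagram) (hA' : ∀ i, (A' i).Nonempty) :
    D.toLink = D'.toLink := by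
  cases nonempty_fintype ι
  have hcommon (S : Finset ι) : ∃ D₁ D₁' : VirtualLinkDiagram, ∃ A₁ A₁',
      D.toLink = D₁.toLink ∧ D'.toLink = D₁'.toLink ∧ (∀ i, (A₁ i).Nonempty) ∧
      (∀ i, (A₁' i).Nonempty) ∧ IsPartialClosure K l σ A₁ D₁.toDiagram ∧
      IsPartialClosure K l σ A₁' D₁'.toDiagram ∧ ∀ i ∈ S, A₁ i = A₁' i := by
    classical
    induction S using Finset.induction_on with
    | empty => exact ⟨D, D', A, A', rfl, rfl, hA, hA', h, h', by simp⟩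
    | insert i S _ ih =>
      obtain ⟨D₁, D₁', A₁, A₁', hD₁, hD₁', hA₁, hA₁', h₁, h₁', hS⟩ := ih
      obtain ⟨R, hR⟩ := h₁.exists_detour hσ hl hA₁ i
      obtain ⟨R', hR'⟩ := h₁'.exists_detour hσ hl hA₁' i
      obtain ⟨c, -, hc, hc'⟩ := exists_genericPoint R R' isOpen_univ ⟨l i, trivial⟩
      obtain ⟨D₂, hD₂, h₂⟩ := hR c hc
      obtain ⟨D₂', hD₂', h₂'⟩ := hR' c hc'
      refine ⟨D₂, D₂', _, _, hD₁.trans hD₂, hD₁'.trans hD₂', fun j => ?_, fun j => ?_, h₂, h₂',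
        fun j hj => ?_⟩
      · exact replaceArc_induction (insert_nonempty _ _) fun _ => hA₁ j
      · exact replaceArc_induction (insert_nonempty _ _) fun _ => hA₁' j
      · by_cases hji : j = i ∨ j = σ i
        · rw [replaceArc_of_mem hji, replaceArc_of_mem hji]
        · rw [replaceArc_of_notMem hji, replaceArc_of_notMem hji]
          exact hS j (Finset.mem_of_mem_insert_of_ne hj (not_or.mp hji).1)
  obtain ⟨D₁, D₁', A₁, A₁', hD₁, hD₁', -, -, h₁, h₁', hA₁⟩ := hcommon Finset.univ
  obtain rfl : A₁ = A₁' := funext fun i => hA₁ i (Finset.mem_univ i)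
  rw [hD₁, hD₁']
  congr 1
  ext e f
  · rw [h₁.edges_eq, h₁'.edges_eq]
  · rw [h₁.isOver_iff, h₁'.isOver_iff]

lemma exists_common_isPartialClosure [Finite ι] (hσ : ∀ i, σ (σ i) = i ∧ σ i ≠ i)
    (hl : l.Injective) (hK : K.endpoints = range l) (hK' : K'.endpoints = range l)
    (hU : IsOpen U) (hne : U.Nonempty) :
    ∃ (A : ι → Set (Sym2 S2)) (D D' : VirtualLinkDiagram),
      IsPartialClosure K l σ A D.toDiagram ∧ IsPartialClosure K' l σ A D'.toDiagram ∧
      (∀ i, (A i).Nonempty) ∧ ∀ i, ∀ e ∈ A i, ∃ j, ∃ c ∈ U, e = s(l j, c) := by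
  cases nonempty_fintype ι
  have hpartial (S : Finset ι) : ∃ A D D', IsPartialClosure K l σ A D ∧
      IsPartialClosure K' l σ A D' ∧ (∀ i ∈ S, (A i).Nonempty) ∧
      ∀ i, ∀ e ∈ A i, ∃ j, ∃ c ∈ U, e = s(l j, c) := by
    classical
    induction S using Finset.induction_on with
    | empty => exact ⟨_, K, K', isPartialClosure_self hK, isPartialClosure_self hK', by simp⟩
    | insert i S _ ih =>
      obtain ⟨A, D, D', h, h', hS, hAU⟩ := ih
      rcases (A i).eq_empty_or_nonempty with hi | hi
      · obtain ⟨c, hcU, hc, hc'⟩ := exists_genericPoint D D' hU hne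
        obtain ⟨D₁, h₁, -⟩ := h.exists_addArc hσ hl hi hc
        obtain ⟨D₁', h₁', -⟩ := h'.exists_addArc hσ hl hi hc'
        refine ⟨_, D₁, D₁', h₁, h₁', fun j hj => ?_, fun j => ?_⟩
        · exact replaceArc_induction (insert_nonempty _ _) fun hji =>
            hS j (Finset.mem_of_mem_insert_of_ne hj (not_or.mp hji).1)
        · refine replaceArc_induction (P := fun B => ∀ e ∈ B, ∃ j, ∃ c ∈ U, e = s(l j, c))
            ?_ fun _ => hAU j
          rintro e (rfl | rfl)
          exacts [⟨i, c, hcU, rfl⟩, ⟨σ i, c, hcU, rfl⟩]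
      · exact ⟨A, D, D', h, h', Finset.forall_mem_insert _ _ _ |>.mpr ⟨hi, hS⟩, hAU⟩
  obtain ⟨A, D, D', h, h', hA, hAU⟩ := hpartial Finset.univ
  have hA (i : ι) : (A i).Nonempty := hA i (Finset.mem_univ i)
  exact ⟨A, ⟨D, h.endpoints_eq_empty hA⟩, ⟨D', h'.endpoints_eq_empty hA⟩, h, h', hA, hAU⟩

end Closure

section Linkoid

variable {n : ℕ} {L : LinkoidDiagram n} {l : L.Labelling} {σ : Equiv.Perm (Fin (2 * n))}

lemma coe_labelling_injective (l : L.Labelling) :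
    Function.Injective fun i => (l i : S2) :=
  Subtype.val_injective.comp l.injective

lemma endpoints_eq_range (l : L.Labelling) : L.endpoints = range fun i => (l i : S2) :=
  ((l.surjective.range_comp Subtype.val).trans Subtype.range_coe).symm

lemma isClosureDiagram_iff (hσ : σ ∈ closurePermutations n) {D : VirtualLinkDiagram} :
    IsClosureDiagram L l σ D ↔ ∃ A, (∀ i, (A i).Nonempty) ∧
      IsPartialClosure L.toDiagram (fun i => l i) σ A D.toDiagram := by
  constructor
  · rintro ⟨A, hpath, hperm, hdisj, hdisjL, hedges, hover⟩
    have hA (i : Fin (2 * n)) : (A i).Nonempty :=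
      (hpath i).nonempty ((coe_labelling_injective l).ne (hσ i).2.symm)
    exact ⟨A, hA, ⟨fun i _ => hpath i, hperm, hdisj, hdisjL⟩, hedges, hover,
      by simp [D.no_endpoints, (hA _).ne_empty]⟩
  · rintro ⟨A, hA, h⟩
    exact ⟨A, fun i => h.isPathBetween i (hA i), h.apply_perm, h.disjoint, h.disjoint_edges,
      h.edges_eq, h.isOver_iff⟩

lemma IsClosureDiagram.toLink_eq (hσ : σ ∈ closurePermutations n) {D D' : VirtualLinkDiagram}
    (h : IsClosureDiagram L l σ D) (h' : IsClosureDiagram L l σ D') : D.toLink = D'.toLink := by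
  obtain ⟨A, hA, h⟩ := (isClosureDiagram_iff hσ).mp h
  obtain ⟨A', hA', h'⟩ := (isClosureDiagram_iff hσ).mp h'
  exact h.toLink_eq hσ (coe_labelling_injective l) hA h' hA'

theorem existsUnique_isVirtualClosure (L : LinkoidDiagram n) (l : L.Labelling)
    (hσ : σ ∈ closurePermutations n) : ∃! v : VirtualLink, IsVirtualClosure L l σ v := by
  have hL := endpoints_eq_range l
  obtain ⟨A, D, -, hD, -, hA, -⟩ := exists_common_isPartialClosure hσ (coe_labelling_injective l)
    hL hL isOpen_univ ⟨⟨EuclideanSpace.single 0 1, by simp⟩, trivial⟩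
  have hD' := (isClosureDiagram_iff hσ).mpr ⟨A, hA, hD⟩
  exact ⟨D.toLink, ⟨D, hD', rfl⟩, fun _ ⟨_, hD'', hv⟩ => hv ▸ hD''.toLink_eq hσ hD'⟩

end Linkoid

section Triangle

variable {p q r u w x P : S2} {e : Sym2 S2} {v : Fin 3 → S2} {b : Module.Basis (Fin 3) ℝ ℝ³}
  {i j k : Fin 3}

lemma Crosses.exists_pos (h : Crosses s(u, w) s(p, q)) :
    ∃ α β γ δ : ℝ, 0 < α ∧ 0 < β ∧ 0 < γ ∧ 0 < δ ∧
      α • (u : ℝ³) + β • (w : ℝ³) = γ • (p : ℝ³) + δ • (q : ℝ³) := by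
  obtain ⟨-, x, hxuw, hxpq, hxuw', hxpq'⟩ := h
  obtain ⟨α, β, hα, hβ, hx⟩ := exists_pos_of_mem_arc hxuw hxuw'
  obtain ⟨γ, δ, hγ, hδ, hx'⟩ := exists_pos_of_mem_arc hxpq hxpq'
  exact ⟨α, β, γ, δ, hα, hβ, hγ, hδ, hx.symm.trans hx'⟩

lemma exists_coord_neg_of_crosses_of_crosses (hb : ∀ i, b i = v i) (hij : i ≠ j) (hik : i ≠ k)
    (hjk : j ≠ k) (hej : Crosses e s(v i, v j)) (hek : Crosses e s(v i, v k)) (hu : u ∈ e) :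
    ∃ m, b.coord m u < 0 := by
  obtain ⟨w, rfl⟩ := hu
  obtain ⟨α, β, c, d, -, hβ, -, hd, hx⟩ := hej.exists_pos
  obtain ⟨γ, δ, c', d', -, hδ, -, hd', hy⟩ := hek.exists_pos
  simp only [← hb] at hx hy
  have hxj : α * b.coord j u + β * b.coord j w = d := by
    simpa [Finsupp.single_apply, hij] using congrArg (b.coord j) hx
  have hxk : α * b.coord k u + β * b.coord k w = 0 := by
    simpa [Finsupp.single_apply, hik, hjk] using congrArg (b.coord k) hx
  have hyj : γ * b.coord j u + δ * b.coord j w = 0 := by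
    simpa [Finsupp.single_apply, hij, hjk.symm] using congrArg (b.coord j) hy
  have hyk : γ * b.coord k u + δ * b.coord k w = d' := by
    simpa [Finsupp.single_apply, hik] using congrArg (b.coord k) hy
  by_contra! hnonneg
  have hpos : 0 < (α * δ - β * γ) * b.coord j u := by
    have : (α * δ - β * γ) * b.coord j u = δ * d := by linear_combination δ * hxj - β * hyj
    rw [this]
    positivity
  have hpos' : 0 < (β * γ - α * δ) * b.coord k u := by
    have : (β * γ - α * δ) * b.coord k u = β * d' := by linear_combination β * hyk - δ * hxk
    rw [this]
    positivity
  have := pos_of_mul_pos_left hpos (hnonneg j)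
  have := pos_of_mul_pos_left hpos' (hnonneg k)
  linarith

lemma coord_neg_of_crosses (hb : ∀ i, b i = v i) (hij : i ≠ j) (hik : i ≠ k)
    (h : Crosses s(v i, u) s(v j, v k)) : b.coord i u < 0 := by
  obtain ⟨α, β, γ, δ, hα, hβ, -, -, hx⟩ := h.exists_pos
  simp only [← hb] at hx
  have hxi : α + β * b.coord i u = 0 := by
    simpa [Finsupp.single_apply, hij.symm, hik.symm] using congrArg (b.coord i) hx
  nlinarith

lemma exists_basis_eq (h : LinearIndependent ℝ ![(p : ℝ³), (q : ℝ³), (r : ℝ³)]) :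
    ∃ b : Module.Basis (Fin 3) ℝ ℝ³, ∀ i, b i = (![p, q, r] i : S2) :=
  ⟨basisOfLinearIndependentOfCardEqFinrank h (by simp), fun i => by fin_cases i <;> simp⟩

lemma mem_triangle_iff (hb : ∀ i, b i = (![p, q, r] i : S2)) :
    x ∈ triangle p q r ↔ ∀ i, 0 ≤ b.coord i x := by
  have hp : (p : ℝ³) = b 0 := (hb 0).symm
  have hq : (q : ℝ³) = b 1 := (hb 1).symm
  have hr : (r : ℝ³) = b 2 := (hb 2).symm
  constructor
  · rintro ⟨α, β, γ, hα, hβ, hγ, hx⟩ i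
    rw [hx, hp, hq, hr]
    fin_cases i <;> simp [hα, hβ, hγ]
  · intro h
    refine ⟨_, _, _, h 0, h 1, h 2, ?_⟩
    rw [hp, hq, hr, ← Fin.sum_univ_three fun i => b.coord i x • b i]
    exact (b.sum_repr x).symm

lemma notMem_triangle_of_crosses_of_crosses
    (h : LinearIndependent ℝ ![(p : ℝ³), (q : ℝ³), (r : ℝ³)])
    (hpr : Crosses e s(p, r)) (hrq : Crosses e s(r, q)) (hu : u ∈ e) : u ∉ triangle p q r := by
  obtain ⟨b, hb⟩ := exists_basis_eq h
  obtain ⟨m, hm⟩ := exists_coord_neg_of_crosses_of_crosses (i := 2) (j := 0) (k := 1) hb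
    (by decide) (by decide) (by decide) (Sym2.eq_swap ▸ hpr) hrq hu
  exact fun hu => hm.not_ge ((mem_triangle_iff hb).mp hu m)

lemma Diagram.Traverses.notMem_triangle (h : LinearIndependent ℝ ![(p : ℝ³), (q : ℝ³), (r : ℝ³)])
    (he : Traverses p q r e) (hu : u ∈ e) : u ∉ triangle p q r := by
  obtain ⟨b, hb⟩ := exists_basis_eq h
  obtain ⟨m, hm⟩ : ∃ m, b.coord m u < 0 := by
    obtain ⟨hpq, hpr | hrq⟩ := he
    · exact exists_coord_neg_of_crosses_of_crosses (i := 0) (j := 1) (k := 2) hb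
        (by decide) (by decide) (by decide) hpq hpr hu
    · exact exists_coord_neg_of_crosses_of_crosses (i := 1) (j := 0) (k := 2) hb
        (by decide) (by decide) (by decide) (Sym2.eq_swap ▸ hpq) (Sym2.eq_swap ▸ hrq) hu
  exact fun hu => hm.not_ge ((mem_triangle_iff hb).mp hu m)

lemma notMem_triangle_of_crosses (h : LinearIndependent ℝ ![(p : ℝ³), (q : ℝ³), (r : ℝ³)])
    (hu : Crosses s(q, u) s(p, r)) : u ∉ triangle p q r := by
  obtain ⟨b, hb⟩ := exists_basis_eq h
  have hneg : b.coord 1 u < 0 := coord_neg_of_crosses (i := 1) (j := 0) (k := 2) hb (by decide)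
    (by decide) hu
  exact fun hu => hneg.not_ge ((mem_triangle_iff hb).mp hu 1)

lemma away_of_coord_neg (hb : ∀ i, b i = (![p, q, r] i : S2)) (hx : ∀ i, b.coord i x < 0)
    (hP : P ∈ triangle p q r → P = p ∨ P = q) : Away p q r s(P, x) := by
  rintro y ⟨hy, hyT⟩
  obtain ⟨α, β, hα, hβ, hyαβ⟩ := mem_arc_mk.mp hy
  rcases hβ.eq_or_lt with rfl | hβ
  · obtain rfl : y = P := eq_of_coe_eq_smul hα (by simpa using hyαβ)
    exact hP hyT
  have hPpos (i : Fin 3) : 0 < b.coord i P := by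
    refine pos_of_mul_pos_right (a := α) ?_ hα
    have hyi : b.coord i y = α * b.coord i P + β * b.coord i x := by simp [hyαβ]
    linarith [(mem_triangle_iff hb).mp hyT i, mul_neg_of_pos_of_neg hβ (hx i)]
  have hP2 : b.coord 2 P = 0 := by
    rcases hP ((mem_triangle_iff hb).mpr fun i => (hPpos i).le) with rfl | rfl
    · simp [show (P : ℝ³) = b 0 from (hb 0).symm]
    · simp [show (P : ℝ³) = b 1 from (hb 1).symm]
  exact absurd hP2 (hPpos 2).ne'

lemma exists_isOpen_away (h : LinearIndependent ℝ ![(p : ℝ³), (q : ℝ³), (r : ℝ³)]) :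
    ∃ U : Set S2, IsOpen U ∧ U.Nonempty ∧
      ∀ c ∈ U, ∀ P, (P ∈ triangle p q r → P = p ∨ P = q) → Away p q r s(P, c) := by
  obtain ⟨b, hb⟩ := exists_basis_eq h
  refine ⟨{c | ∀ i, b.coord i c < 0}, ?_, ?_, fun c hc P => away_of_coord_neg hb hc⟩
  · simp only [ofPred_forall]
    exact isOpen_iInter_of_finite fun i => isOpen_lt
      ((b.coord i).continuous_of_finiteDimensional.comp continuous_subtype_val) continuous_const
  · obtain ⟨y, hy⟩ : ∃ y, ∀ i, b.coord i y = -1 := ⟨-∑ j, b j, by simp⟩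
    have hy0 : y ≠ 0 := fun h0 => by simpa [h0] using hy 0
    refine ⟨⟨‖y‖⁻¹ • y, by simp [norm_smul, hy0]⟩, fun i => ?_⟩
    rw [map_smul, hy, smul_eq_mul, mul_neg_one, neg_lt_zero]
    exact inv_pos.mpr (norm_pos_iff.mpr hy0)

end Triangle

section Replaces

variable {K K' D D' : Diagram} {B : Set (Sym2 S2)} {p q r x : S2} {e f : Sym2 S2}

lemma Diagram.Replaces.endpoints_eq (h : Replaces K K' p q r) : K.endpoints = K'.endpoints := by
  obtain ⟨hLI, hpq_mem, hpr_mem, hrq_mem, hedges, -⟩ := h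
  have hv : Function.Injective ![p, q, r] := fun i j hij =>
    hLI.injective (by fin_cases i <;> fin_cases j <;> simp_all)
  have hpq : p ≠ q := hv.ne (a₁ := 0) (a₂ := 1) (by decide)
  have hpr : p ≠ r := hv.ne (a₁ := 0) (a₂ := 2) (by decide)
  have hqr : q ≠ r := hv.ne (a₁ := 1) (a₂ := 2) (by decide)
  rw [Sym2.eq_swap (a := r)] at hrq_mem hedges
  refine endpoints_eq_of_replace_path (isPathBetween_singleton hpq)
    (isPathBetween_pair hpq hpr hqr) hpq disjoint_sdiff_left ?_ ?_ hedges
  · simp [disjoint_insert_right, hpr_mem, hrq_mem]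
  · rw [sdiff_union_of_subset (singleton_subset_iff.mpr hpq_mem)]

lemma Diagram.Away.eq_or_eq (h : Away p q r e) (hx : x ∈ e) (hxT : x ∈ triangle p q r) :
    x = p ∨ x = q :=
  h ⟨mem_arc_of_mem hx, hxT⟩

lemma eq_or_eq_of_mem_endpoints
    (h : ∀ e ∈ K.edges \ {s(p, q)}, ∀ x ∈ e, x ∈ triangle p q r → x = p ∨ x = q)
    (hx : x ∈ K.endpoints) (hxT : x ∈ triangle p q r) : x = p ∨ x = q := by
  obtain ⟨e, ⟨he, hxe⟩, -⟩ := hx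
  by_cases hepq : e = s(p, q)
  · exact Sym2.mem_iff.mp (hepq ▸ hxe)
  · exact h e ⟨he, hepq⟩ x hxe hxT

lemma not_isOver_of_notMem (he : e ∉ K.edges) : ¬K.isOver e f ∧ ¬K.isOver f e :=
  ⟨fun h => he (K.crosses_of_isOver _ _ h).1, fun h => he (K.crosses_of_isOver _ _ h).2.1⟩

/-- `D` and `D'` arise from `K` and `K'` by adding the same set `B` of edges, which have only
virtual crossings and stay away from the triangle `pqr`. -/
structure IsCommonExtension (p q r : S2) (B : Set (Sym2 S2)) (K K' D D' : Diagram) : Prop where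
  edges_eq : D.edges = K.edges ∪ B
  edges_eq' : D'.edges = K'.edges ∪ B
  disjoint : Disjoint K.edges B
  disjoint' : Disjoint K'.edges B
  isOver_iff : ∀ e f, D.isOver e f ↔ K.isOver e f
  isOver_iff' : ∀ e f, D'.isOver e f ↔ K'.isOver e f
  away : ∀ e ∈ B, Away p q r e

namespace IsCommonExtension

variable (h : IsCommonExtension p q r B K K' D D')

include h

lemma mem_or_mem (he : e ∈ D.edges \ {s(p, q)}) : e ∈ K.edges \ {s(p, q)} ∨ e ∈ B := by
  have heD : e ∈ K.edges ∪ B := h.edges_eq ▸ he.1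
  exact heD.imp_left fun heK => ⟨heK, he.2⟩

lemma mem_edges_sdiff (he : e ∈ K.edges \ {s(p, q)}) : e ∈ D.edges \ {s(p, q)} :=
  ⟨h.edges_eq ▸ .inl he.1, he.2⟩

lemma not_isOver (he : e ∈ B) : ¬D.isOver e f ∧ ¬D.isOver f e := by
  simpa only [h.isOver_iff] using not_isOver_of_notMem (h.disjoint.notMem_of_mem_right he)

lemma not_isOver' (he : e ∈ B) : ¬D'.isOver e f ∧ ¬D'.isOver f e := by
  simpa only [h.isOver_iff'] using not_isOver_of_notMem (h.disjoint'.notMem_of_mem_right he)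

lemma classical_iff : D.Classical e f ↔ K.Classical e f :=
  or_congr (h.isOver_iff e f) (h.isOver_iff f e)

lemma classical_iff' : D'.Classical e f ↔ K'.Classical e f :=
  or_congr (h.isOver_iff' e f) (h.isOver_iff' f e)

lemma sameType_iff : SameType D D' p q r e ↔ SameType K K' p q r e := by
  simp only [SameType, h.isOver_iff, h.isOver_iff']

lemma replaces (hK : Replaces K K' p q r) : Replaces D D' p q r := by
  obtain ⟨hLI, hpq, hpr, hrq, hedges, hover⟩ := hK
  have hpq_notMem : s(p, q) ∉ B := h.disjoint.notMem_of_mem_left hpq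
  have hB {g : Sym2 S2} (hg : g ∈ ({s(p, r), s(r, q)} : Set (Sym2 S2))) : g ∉ B :=
    h.disjoint'.notMem_of_mem_left (hedges ▸ .inr hg)
  refine ⟨hLI, ?_, ?_, ?_, ?_, fun e he f hf => ?_⟩
  · simp [h.edges_eq, hpq]
  · simp [h.edges_eq, hpr, hB (mem_insert _ _)]
  · simp [h.edges_eq, hrq, hB (mem_insert_of_mem _ rfl)]
  · rw [h.edges_eq', h.edges_eq, hedges, union_sdiff_distrib, sdiff_singleton_eq_self hpq_notMem,
      union_right_comm]
  · rcases h.mem_or_mem he with heK | heB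
    · rcases h.mem_or_mem hf with hfK | hfB
      · rw [h.isOver_iff, h.isOver_iff', hover e heK f hfK]
      · exact iff_of_false (h.not_isOver' hfB).2 (h.not_isOver hfB).2
    · exact iff_of_false (h.not_isOver' heB).1 (h.not_isOver heB).1

lemma inter_triangle_eq_empty (hpq : s(p, q) ∈ D.edges) (heB : e ∈ B)
    (he : e ∈ D.edges \ {s(p, q)}) (hf : f ∈ D.edges \ {s(p, q)}) (hef : e ≠ f) :
    arc e ∩ arc f ∩ triangle p q r = ∅ := by
  refine eq_empty_of_forall_notMem fun x ⟨⟨hxe, hxf⟩, hxT⟩ => ?_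
  have hx : x ∈ arc s(p, q) := by
    rcases h.away e heB ⟨hxe, hxT⟩ with rfl | rfl <;> exact mem_arc_of_mem (by simp)
  exact (D.no_triple e he.1 f hf.1 _ hpq hef hf.2 he.2).subset ⟨⟨hxe, hxf⟩, hx⟩

lemma isotopy (hK : Replaces K K' p q r)
    (haway : ∀ e ∈ K.edges \ {s(p, q)}, Away p q r e ∨ Traverses p q r e)
    (hdisj : ∀ e ∈ K.edges \ {s(p, q)}, ∀ f ∈ K.edges \ {s(p, q)}, e ≠ f →
      arc e ∩ arc f ∩ triangle p q r = ∅)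
    (htype : ∀ e ∈ K.edges \ {s(p, q)}, SameType K K' p q r e) : Isotopy D D' := by
  have hD := h.replaces hK
  refine ⟨p, q, r, hD, fun e he => ?_, fun e he f hf hef => ?_, fun e he => ?_⟩
  · exact (h.mem_or_mem he).elim (haway e) fun heB => .inl (h.away e heB)
  · rcases h.mem_or_mem he with heK | heB
    · rcases h.mem_or_mem hf with hfK | hfB
      · exact hdisj e heK f hfK hef
      · rw [inter_comm (arc e)]
        exact h.inter_triangle_eq_empty hD.2.1 hfB hf he hef.symm
    · exact h.inter_triangle_eq_empty hD.2.1 heB he hf hef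
  · rcases h.mem_or_mem he with heK | heB
    · exact h.sameType_iff.mpr (htype e heK)
    · exact fun g _ _ => ⟨iff_of_false (h.not_isOver' heB).1 (h.not_isOver heB).1,
        iff_of_false (h.not_isOver' heB).2 (h.not_isOver heB).2⟩

lemma away_of_away {P : Sym2 S2 → Prop} (hK : ∀ e ∈ K.edges \ {s(p, q)}, P e → Away p q r e) :
    ∀ e ∈ D.edges \ {s(p, q)}, P e → Away p q r e :=
  fun e he hP => (h.mem_or_mem he).elim (fun heK => hK e heK hP) (h.away e)

end IsCommonExtension

end Replaces

section Spectrum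

variable {n : ℕ} {L L' : LinkoidDiagram n} {l : L.Labelling} {l' : L'.Labelling} {p q r : S2}

lemma spec_eq_of_common_closures
    (h : ∀ σ ∈ closurePermutations n, ∃ D D', IsClosureDiagram L l σ D ∧
      IsClosureDiagram L' l' σ D' ∧ D.toLink = D'.toLink) : spec L l = spec L' l' := by
  ext v
  refine exists_congr fun σ => and_congr_right fun hσ => ?_
  obtain ⟨D, D', hD, hD', hDD'⟩ := h σ hσ
  constructor
  · rintro ⟨D₁, hD₁, rfl⟩
    exact ⟨D', hD', hDD'.symm.trans (hD.toLink_eq hσ hD₁)⟩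
  · rintro ⟨D₁, hD₁, rfl⟩
    exact ⟨D, hD, hDD'.trans (hD'.toLink_eq hσ hD₁)⟩

lemma spec_eq_spec (L : LinkoidDiagram n) (l l' : L.Labelling) : spec L l = spec L l' := by
  have hsubset (l l' : L.Labelling) : spec L l ⊆ spec L l' := by
    rintro v ⟨σ, hσ, D, ⟨A, hpath, hperm, hdisj, hdisjL, hedges, hover⟩, rfl⟩
    let τ : Equiv.Perm (Fin (2 * n)) := l'.trans l.symm
    have hl (i : Fin (2 * n)) : l' i = l (τ i) := by simp [τ]
    refine ⟨(τ.trans σ).trans τ.symm, fun i => ⟨?_, fun hi => ?_⟩, D,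
      ⟨fun i => A (τ i), fun i => ?_, fun i => ?_, fun i j hij hij' => ?_, fun i => hdisjL _, ?_,
        hover⟩, rfl⟩
    · simp [(hσ _).1]
    · exact (hσ (τ i)).2 (τ.symm_apply_eq.mp hi)
    · simpa [hl] using hpath (τ i)
    · simpa using hperm (τ i)
    · exact hdisj _ _ (τ.injective.ne hij) fun hj => hij' (τ.eq_symm_apply.mpr hj)
    · rw [hedges, τ.surjective.iUnion_comp A]
  exact (hsubset l l').antisymm (hsubset l' l)

lemma spec_eq_of_replaces (h : Replaces L.toDiagram L'.toDiagram p q r)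
    (hT : ∀ e ∈ L.edges \ {s(p, q)}, ∀ x ∈ e, x ∈ triangle p q r → x = p ∨ x = q)
    (hmove : ∀ (D D' : VirtualLinkDiagram) (B : Set (Sym2 S2)),
      IsCommonExtension p q r B L.toDiagram L'.toDiagram D.toDiagram D'.toDiagram →
        VirtualMove D D')
    (l : L.Labelling) (l' : L'.Labelling) : spec L l = spec L' l' := by
  let l'' : L'.Labelling := l.trans (Equiv.setCongr h.endpoints_eq)
  rw [spec_eq_spec L' l' l'']
  refine spec_eq_of_common_closures fun σ hσ => ?_
  obtain ⟨U, hU, hne, haway⟩ := exists_isOpen_away h.1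
  obtain ⟨A, D, D', hD, hD', hA, hAU⟩ := exists_common_isPartialClosure hσ
    (coe_labelling_injective l) (endpoints_eq_range l) (endpoints_eq_range l'') hU hne
  refine ⟨D, D', (isClosureDiagram_iff hσ).mpr ⟨A, hA, hD⟩,
    (isClosureDiagram_iff hσ).mpr ⟨A, hA, hD'⟩, (hmove D D' (⋃ i, A i)
      ⟨hD.edges_eq, hD'.edges_eq, disjoint_iUnion_right.mpr hD.disjoint_edges,
        disjoint_iUnion_right.mpr hD'.disjoint_edges, hD.isOver_iff, hD'.isOver_iff,
        fun e he => ?_⟩).toLink_eq⟩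
  obtain ⟨i, hi⟩ := mem_iUnion.mp he
  obtain ⟨j, c, hc, rfl⟩ := hAU i e hi
  exact haway c hc _ (eq_or_eq_of_mem_endpoints hT (l j).2)

lemma spec_eq_of_isotopy (h : Isotopy L.toDiagram L'.toDiagram) (l : L.Labelling)
    (l' : L'.Labelling) : spec L l = spec L' l' := by
  obtain ⟨p, q, r, hL, haway, hdisj, htype⟩ := h
  refine spec_eq_of_replaces hL (fun e he x hx hxT => ?_)
    (fun D D' B hB => .inl (hB.isotopy hL haway hdisj htype)) l l'
  exact (haway e he).elim (fun he => he.eq_or_eq hx hxT) fun he =>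
    absurd hxT (he.notMem_triangle hL.1 hx)

lemma spec_eq_of_reidemeisterI (h : ReidemeisterI L.toDiagram L'.toDiagram) (l : L.Labelling)
    (l' : L'.Labelling) : spec L l = spec L' l' := by
  obtain ⟨p, q, r, s, hL, hqs, hcross, hclassical, haway⟩ := h
  refine spec_eq_of_replaces hL (fun e he x hx hxT => ?_) (fun D D' B hB => .inr (.inl ?_)) l l'
  · by_cases hes : e = s(q, s)
    · subst hes
      rcases Sym2.mem_iff.mp hx with rfl | rfl
      · exact .inr rfl
      · exact absurd hxT (notMem_triangle_of_crosses hL.1 hcross)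
    · exact (haway e he hes).eq_or_eq hx hxT
  · exact ⟨p, q, r, s, hB.replaces hL, hB.mem_edges_sdiff hqs, hcross,
      hB.classical_iff'.mpr hclassical, hB.away_of_away haway⟩

lemma spec_eq_of_reidemeisterII (h : ReidemeisterII L.toDiagram L'.toDiagram) (l : L.Labelling)
    (l' : L'.Labelling) : spec L l = spec L' l' := by
  obtain ⟨p, q, r, e, hL, he, hpr, hrq, hover, haway⟩ := h
  refine spec_eq_of_replaces hL (fun f hf x hx hxT => ?_)
    (fun D D' B hB => .inr (.inr (.inl ?_))) l l'
  · by_cases hfe : f = e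
    · subst hfe
      exact absurd hxT (notMem_triangle_of_crosses_of_crosses hL.1 hpr hrq hx)
    · exact (haway f hf hfe).eq_or_eq hx hxT
  · refine ⟨p, q, r, e, hB.replaces hL, hB.mem_edges_sdiff he, hpr, hrq, ?_, hB.away_of_away haway⟩
    simpa only [hB.isOver_iff'] using hover

lemma spec_eq_of_reidemeisterIII (h : ReidemeisterIII L.toDiagram L'.toDiagram) (l : L.Labelling)
    (l' : L'.Labelling) : spec L l = spec L' l' := by
  obtain ⟨p, q, r, e, f, hL, he, hf, hef, hte, htf, hmeet, hover, hse, hsf, haway⟩ := h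
  refine spec_eq_of_replaces hL (fun g hg x hx hxT => ?_)
    (fun D D' B hB => .inr (.inr (.inr (.inl ?_)))) l l'
  · by_cases hge : g = e
    · exact absurd hxT (hte.notMem_triangle hL.1 (hge ▸ hx))
    by_cases hgf : g = f
    · exact absurd hxT (htf.notMem_triangle hL.1 (hgf ▸ hx))
    exact (haway g hg hge hgf).eq_or_eq hx hxT
  · refine ⟨p, q, r, e, f, hB.replaces hL, hB.mem_edges_sdiff he, hB.mem_edges_sdiff hf, hef,
      hte, htf, hmeet, ?_, hB.sameType_iff.mpr hse, hB.sameType_iff.mpr hsf, fun g hg hge hgf =>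
        hB.away_of_away (P := fun g => g ≠ e ∧ g ≠ f) (fun g hg hP => haway g hg hP.1 hP.2) g hg
          ⟨hge, hgf⟩⟩
    simpa only [hB.isOver_iff, hB.classical_iff] using hover

end Spectrum

section EndpointIsotopy

variable {ι : Type*} {σ : Equiv.Perm ι} {l l' : ι → S2} {A : ι → Set (Sym2 S2)} {k : ι}
  {K K' D : Diagram} {S : Set S2} {p p' x : S2}

open scoped Classical in
lemma mem_symmDiff_pair_iff (hp : p ∈ S) (hp' : p' ∉ S) :
    x ∈ symmDiff S {p, p'} ↔ Equiv.swap p p' x ∈ S := by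
  by_cases hxp : x = p
  · simp [Set.mem_symmDiff, hxp, hp, hp']
  by_cases hxp' : x = p'
  · simp [Set.mem_symmDiff, hxp', hp, hp']
  simp [Set.mem_symmDiff, Equiv.swap_apply_of_ne_of_ne hxp hxp', hxp, hxp']

lemma endpoints_eq_symmDiff_of_edges_eq_insert (hpp' : s(p, p') ∉ K.edges)
    (hedges : K'.edges = insert s(p, p') K.edges) :
    K'.endpoints = symmDiff K.endpoints {p, p'} := by
  have hne : p ≠ p' := (K'.nondegenerate p p' (hedges ▸ mem_insert _ _)).1
  exact endpoints_eq_symmDiff (isPathBetween_singleton hne) hne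
    (disjoint_singleton_right.mpr hpp') (hedges.trans union_singleton.symm)

lemma notMem_endpoints_of_inter_subset (hedges : K'.edges = insert s(p, p') K.edges)
    (hmeet : ∀ e ∈ K.edges, arc e ∩ arc s(p, p') ⊆ {p}) : p' ∉ K.endpoints := by
  rintro ⟨e, ⟨he, hpe⟩, -⟩
  have hp' : p' = p := hmeet e he ⟨mem_arc_of_mem hpe, mem_arc_of_mem (Sym2.mem_mk_right p p')⟩
  exact (K'.nondegenerate p p' (hedges ▸ mem_insert _ _)).1 hp'.symm

lemma IsPartialClosure.insert_edge (hσ : ∀ i, σ (σ i) = i ∧ σ i ≠ i) (hl : l.Injective)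
    (h : IsPartialClosure K' l' σ A D) (hA : ∀ i, (A i).Nonempty) (hk : l k ∈ K.endpoints)
    (hK : s(l k, l' k) ∉ K.edges) (hedges : K'.edges = insert s(l k, l' k) K.edges)
    (hover : ∀ e f, K'.isOver e f ↔ K.isOver e f) (hll' : ∀ i, i ≠ k → l i = l' i) :
    IsPartialClosure K l σ (replaceArc σ A k (insert s(l k, l' k) (A k))) D := by
  have hnew : s(l k, l' k) ∈ K'.edges := hedges ▸ mem_insert _ _
  have hKK' : K.edges ⊆ K'.edges := hedges ▸ subset_insert _ _
  have hnewA (i : ι) : s(l k, l' k) ∉ A i := (h.disjoint_edges i).notMem_of_mem_left hnew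
  have hA_notMem : ∀ e ∈ A k, l k ∉ e := fun e he hke => by
    obtain ⟨e₀, ⟨he₀, hke₀⟩, -⟩ := hk
    exact (D.no_triple e₀ (h.edges_subset (hKK' he₀)) _ (h.edges_subset hnew) e
      (h.arc_subset k he) (ne_of_mem_of_not_mem he₀ hK) (ne_of_mem_of_not_mem he (hnewA k)).symm
      ((h.disjoint_edges k).ne_of_mem (hKK' he₀) he)).subset
      ⟨⟨mem_arc_of_mem hke₀, mem_arc_of_mem (Sym2.mem_mk_left _ _)⟩, mem_arc_of_mem hke⟩
  have hpath : IsPathBetween (insert s(l k, l' k) (A k)) (l k) (l (σ k)) := by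
    have hAk := h.isPathBetween k (hA k)
    rw [← hll' _ (hσ k).2] at hAk
    exact hAk.cons (K'.nondegenerate _ _ hnew).1 (hl.ne (hσ k).2.symm) hA_notMem
  refine { h.toIsArcSystem.replaceArc (fun i => (hσ i).1)
    (fun j hj => hll' j (not_or.mp hj).1) hKK' (fun _ => hpath)
    (disjoint_insert_right.mpr ⟨hK, (h.disjoint_edges k).mono_left hKK'⟩)
    (fun j hj => disjoint_insert_right.mpr
      ⟨hnewA j, (h.disjoint k j (not_or.mp hj).1 (not_or.mp hj).2).symm⟩) with
    edges_eq := ?_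
    isOver_iff := fun e f => (h.isOver_iff e f).trans (hover e f)
    endpoints_eq := ?_ }
  · rw [iUnion_replaceArc, union_insert, ← iUnion_replaceArc, replaceArc_self (h.apply_perm k),
      union_insert, ← insert_union, ← hedges, h.edges_eq]
  · have hne (i : ι) : replaceArc σ A k (insert s(l k, l' k) (A k)) i ≠ ∅ :=
      replaceArc_induction (P := (· ≠ ∅)) (insert_nonempty _ _).ne_empty fun _ => (hA i).ne_empty
    simp [h.endpoints_eq_empty hA, hne]

end EndpointIsotopy

section Invariance

variable {n : ℕ} {L L' : LinkoidDiagram n}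

lemma exists_labelling_of_endpoints_eq_symmDiff {p p' : S2}
    (hL : L'.endpoints = symmDiff L.endpoints {p, p'}) (hp : p ∈ L.endpoints)
    (hp' : p' ∉ L.endpoints) (l' : L'.Labelling) :
    ∃ (l : L.Labelling) (k : Fin (2 * n)),
      (l k : S2) = p ∧ (l' k : S2) = p' ∧ ∀ i, i ≠ k → (l i : S2) = l' i := by
  classical
  have hmem (x : S2) : x ∈ L'.endpoints ↔ Equiv.swap p p' x ∈ L.endpoints :=
    hL ▸ mem_symmDiff_pair_iff hp hp'
  obtain ⟨k, hk⟩ := l'.surjective ⟨p', (hmem p').mpr (by rwa [Equiv.swap_apply_right])⟩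
  refine ⟨l'.trans ((Equiv.swap p p').subtypeEquiv hmem), k, ?_, by rw [hk], fun i hi => ?_⟩
  · simp [hk]
  · have hip : (l' i : S2) ≠ p := fun hip =>
      hp' (by simpa [hip] using (hmem (l' i)).mp (l' i).2)
    have hip' : (l' i : S2) ≠ p' := fun hip' =>
      hi (l'.injective (Subtype.ext (by rw [hip', hk])))
    exact Equiv.swap_apply_of_ne_of_ne hip hip'

lemma spec_eq_of_endpointIsotopy (h : EndpointIsotopy L.toDiagram L'.toDiagram)
    (l : L.Labelling) (l' : L'.Labelling) : spec L l = spec L' l' := by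
  obtain ⟨p, p', hp, hpp', hedges, hmeet, hover⟩ := h
  obtain ⟨l'', k, rfl, rfl, hll'⟩ := exists_labelling_of_endpoints_eq_symmDiff
    (endpoints_eq_symmDiff_of_edges_eq_insert hpp' hedges) hp
    (notMem_endpoints_of_inter_subset hedges hmeet) l'
  rw [spec_eq_spec L l l'']
  refine spec_eq_of_common_closures fun σ hσ => ?_
  obtain ⟨-, ⟨D, hD, rfl⟩, -⟩ := existsUnique_isVirtualClosure L' l' hσ
  obtain ⟨A, hA, hAD⟩ := (isClosureDiagram_iff hσ).mp hD
  exact ⟨D, D, (isClosureDiagram_iff hσ).mpr ⟨_,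
    fun i => replaceArc_induction (P := Set.Nonempty) (insert_nonempty _ _) fun _ => hA i,
    hAD.insert_edge hσ (coe_labelling_injective l'') hA hp hpp' hedges hover hll'⟩, hD, rfl⟩

lemma nonempty_labelling (L : LinkoidDiagram n) : Nonempty L.Labelling := by
  have : Finite L.endpoints := L.finite_vertices.subset L.endpoints_subset_vertices
  exact ⟨(Finite.equivFinOfCardEq L.card_endpoints).symm⟩

theorem spec_eq_of_linkoidEquiv (h : LinkoidEquiv L L') (l : L.Labelling) (l' : L'.Labelling) :
    spec L l = spec L' l' := by
  induction h with
  | rel L L' h =>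
    rcases h with h | h | h | h | h
    · exact spec_eq_of_isotopy h l l'
    · exact spec_eq_of_endpointIsotopy h l l'
    · exact spec_eq_of_reidemeisterI h l l'
    · exact spec_eq_of_reidemeisterII h l l'
    · exact spec_eq_of_reidemeisterIII h l l'
  | refl L => exact spec_eq_spec L l l'
  | symm L L' _ ih => exact (ih l' l).symm
  | trans L M L' _ _ ih ih' =>
    obtain ⟨m⟩ := nonempty_labelling M
    exact (ih l m).trans (ih' m l')

end Invariance

end VirtualSpectrum

theorem theorem5p1 (n : ℕ) :
    (∀ (L : VirtualSpectrum.LinkoidDiagram n) (l : L.Labelling),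
      ∀ σ ∈ VirtualSpectrum.closurePermutations n,
        ∃! v : VirtualSpectrum.VirtualLink, VirtualSpectrum.IsVirtualClosure L l σ v) ∧
    (∀ (L L' : VirtualSpectrum.LinkoidDiagram n) (l : L.Labelling) (l' : L'.Labelling),
      VirtualSpectrum.LinkoidEquiv L L' →
        VirtualSpectrum.spec L l = VirtualSpectrum.spec L' l') :=
  ⟨fun L l _ hσ => VirtualSpectrum.existsUnique_isVirtualClosure L l hσ,
    fun _ _ l l' h => VirtualSpectrum.spec_eq_of_linkoidEquiv h l l'⟩
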